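/- Let $k$ be a field and let $H$ be a Hopf algebra over $k$ with bijective antipode $S$. Let $A$ be a right $H$-comodule algebra with coaction $a\mapsto a_{[0]}\otimes a_{[1]}$, and let $B=A^{\mathrm{co}H}=\{a\in A: a_{[0]}\otimes a_{[1]}=a\otimes 1\}$. Assume that $A$ is a faithfully flat $H$-Galois extension of $B$: $A$ is faithfully flat as a right $B$-module and the map $A\otimes_B A\to A\otimes H$, $a\otimes_B b\mapsto a_{[0]}b\otimes a_{[1]}$, is bijective. Let $M$ be a left $B$-module. Then $A\otimes_B M$ is a left $A$-module and a right $H$-comodule via $a\otimes_B m\mapsto (a_{[0]}\otimes_B m)\otimes a_{[1]}$. Let $E$ be the set of all left $A$-linear endomorphisms $f$ of $P=A\otimes_B M$ that are rational, that is, for which there is an element $f_{[0]}\otimes f_{[1]}\in{}_A\mathrm{End}(P)\otimes H$ (necessarily unique) such that, writing $\rho$ for the coaction of $P$, $$\rho(f(p))=f_{[0]}(p_{[0]})\otimes p_{[1]}f_{[1]}\qquad\text{for all }p\in P.$$ With the multiplication opposite to composition and the coaction $f\mapsto f_{[0]}\otimes f_{[1]}$, $E$ is a right $H$-comodule algebra.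 Let $E^{\mathrm{co}H}$ be its subalgebra of coinvariants, let $\Omega_E$ be the set of right $H$-colinear $k$-algebra maps $t:H\to E$, and let $\overline{\Omega}_E=\Omega_E/\!\sim$, where $t_1\sim t_2$ if and only if there is a unit $b$ of $E^{\mathrm{co}H}$ such that $b\,t_1(h)=t_2(h)\,b$ for all $h\in H$. Then there is a bijective correspondence between the isomorphism classes of left $A$-module structures on $M$ that extend the given $B$-module structure (two structures being isomorphic if the resulting $A$-modules are isomorphic) and the elements of $\overline{\Omega}_E$. More precisely, the bijection can be chosen so that the class of an $A$-module structure $(a,m)\mapsto a\cdot m$ corresponds to the class of some $t\in\Omega_E$ satisfying $$1\otimes_B (a\cdot m)=t(S(a_{[1]}))(a_{[0]}\otimes_B m)\qquad\text{for all }a\in A,\ m\in M.$$ -/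

import Mathlib

open scoped TensorProduct
open Coalgebra HopfAlgebra MulOpposite

universe v u

set_option linter.unusedSectionVars false

noncomputable section

namespace HopfLifting

/-- The antipode of the Hopf algebra `H` is bijective. -/
class HasBijectiveAntipode (k : Type v) (H : Type u) [Field k] [Ring H] [HopfAlgebra k H] :
    Prop where
  bijective : Function.Bijective (antipode k : H →ₗ[k] H)

/-- A right `H`-comodule: `coact p = p₍₀₎ ⊗ p₍₁₎`, coassociative and counital. -/
class RightComodule (k : Type v) (H P : Type u) [Field k] [Ring H] [HopfAlgebra k H]
    [AddCommGroup P] [Module k P] where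
  coact : P →ₗ[k] P ⊗[k] H
  coassoc : (TensorProduct.assoc k P H H).toLinearMap ∘ₗ coact.rTensor H ∘ₗ coact =
    (comul (R := k) (A := H)).lTensor P ∘ₗ coact
  counit_coact : (TensorProduct.rid k P).toLinearMap ∘ₗ
    (counit (R := k) (A := H)).lTensor P ∘ₗ coact = LinearMap.id

/-- A right `H`-comodule algebra: an algebra and a right `H`-comodule such that the coaction
`A → A ⊗ H` is multiplicative and unital. -/
class RightComoduleAlgebra (k : Type v) (H A : Type u) [Field k] [Ring H] [HopfAlgebra k H]
    [Ring A] [Algebra k A] extends RightComodule k H A where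
  coact_one : coact (1 : A) = 1
  coact_mul : ∀ a b : A, coact (a * b) = coact a * coact b

open RightComodule (coact)

section ComoduleAlgebra

variable (k : Type v) (H A : Type u) [Field k] [Ring H] [HopfAlgebra k H]
  [Ring A] [Algebra k A] [RightComoduleAlgebra k H A]

/-- The coinvariants `A^{co H} = {a | ρ(a) = a ⊗ 1}`, a subalgebra of `A`. -/
def coinvariants : Subalgebra k A where
  carrier := {a | coact (k := k) (H := H) a = a ⊗ₜ[k] (1 : H)}
  mul_mem' := by
    intro a b ha hb
    simp only [Set.mem_ofPred_eq] at ha hb ⊢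
    rw [RightComoduleAlgebra.coact_mul, ha, hb, Algebra.TensorProduct.tmul_mul_tmul, one_mul]
  add_mem' := by
    intro a b ha hb
    simp only [Set.mem_ofPred_eq] at ha hb ⊢
    rw [map_add, ha, hb, TensorProduct.add_tmul]
  algebraMap_mem' := by
    intro r
    simp only [Set.mem_ofPred_eq]
    rw [Algebra.algebraMap_eq_smul_one, map_smul, RightComoduleAlgebra.coact_one,
      Algebra.TensorProduct.one_def, TensorProduct.smul_tmul']

/-- `Ω_A`: the right `H`-colinear algebra maps `t : H → A`, that is,
`ρ(t(h)) = t(h₍₁₎) ⊗ h₍₂₎`. -/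
def Omega : Type u :=
  {t : H →ₐ[k] A // ∀ h : H,
    coact (k := k) (H := H) (t h) = t.toLinearMap.rTensor H (comul (R := k) h)}

/-- `t₁ ∼ t₂` if and only if `b t₁(h) = t₂(h) b` for some unit `b` of `A^{co H}`. -/
def omegaSetoid : Setoid (Omega k H A) where
  r t₁ t₂ := ∃ b : (coinvariants k H A)ˣ, ∀ h : H,
    ((b : coinvariants k H A) : A) * t₁.1 h = t₂.1 h * ((b : coinvariants k H A) : A)
  iseqv := by
    refine ⟨fun t => ⟨1, fun h => by simp⟩, ?_, ?_⟩
    · rintro t₁ t₂ ⟨b, hb⟩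
      refine ⟨b⁻¹, fun h => ?_⟩
      have h1 : (((b⁻¹ : (coinvariants k H A)ˣ) : coinvariants k H A) : A) *
          ((b : coinvariants k H A) : A) = 1 := by
        rw [← Subalgebra.coe_mul, Units.inv_mul, Subalgebra.coe_one]
      have h2 : ((b : coinvariants k H A) : A) *
          (((b⁻¹ : (coinvariants k H A)ˣ) : coinvariants k H A) : A) = 1 := by
        rw [← Subalgebra.coe_mul, Units.mul_inv, Subalgebra.coe_one]
      calc _ = (((b⁻¹ : (coinvariants k H A)ˣ) : coinvariants k H A) : A) *
            (t₂.1 h * ((b : coinvariants k H A) : A)) *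
            (((b⁻¹ : (coinvariants k H A)ˣ) : coinvariants k H A) : A) := by
              rw [mul_assoc, mul_assoc (t₂.1 h), h2, mul_one]
        _ = _ := by rw [← hb h, ← mul_assoc, h1, one_mul]
    · rintro t₁ t₂ t₃ ⟨b, hb⟩ ⟨c, hc⟩
      refine ⟨c * b, fun h => ?_⟩
      rw [Units.val_mul, Subalgebra.coe_mul, mul_assoc, hb, ← mul_assoc, hc, mul_assoc]

/-- `Ω̄_A = Ω_A / ∼`. -/
def OmegaBar : Type u := Quotient (omegaSetoid k H A)

end ComoduleAlgebra

section Balanced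

variable {k : Type v} {A : Type u} [Field k] [Ring A] [Algebra k A] (B : Subalgebra k A)
  (N : Type u) [AddCommGroup N] [Module k N] [Module B N] [IsScalarTower k B N]

/-- The relations `ab ⊗ n - a ⊗ bn`, whose `k`-span is an `A`-submodule of `A ⊗[k] N`. -/
def balancedRel : Submodule A (A ⊗[k] N) :=
  { Submodule.span k {x : A ⊗[k] N | ∃ (a : A) (b : B) (n : N),
      x = (a * (b : A)) ⊗ₜ[k] n - a ⊗ₜ[k] (b • n)} with
    smul_mem' := by
      intro c x hx
      induction hx using Submodule.span_induction with
      | mem x h =>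
        obtain ⟨a, b, n, rfl⟩ := h
        refine Submodule.subset_span ⟨c * a, b, n, ?_⟩
        rw [smul_sub, TensorProduct.smul_tmul', TensorProduct.smul_tmul', smul_eq_mul,
          smul_eq_mul, mul_assoc]
      | zero => rw [smul_zero]; exact Submodule.zero_mem _
      | add x y _ _ hx hy => rw [smul_add]; exact Submodule.add_mem _ hx hy
      | smul r x _ hx => rw [smul_comm]; exact Submodule.smul_mem _ r hx }

/-- The tensor product `A ⊗_B N` over the (noncommutative) subalgebra `B`, for a left
`B`-module `N`; it is a left `A`-module. -/
abbrev BalTensor : Type u := (A ⊗[k] N) ⧸ balancedRel B N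

variable {N}

/-- The pure tensor `a ⊗_B n`. -/
def btmul (a : A) (n : N) : BalTensor B N := Submodule.Quotient.mk (a ⊗ₜ[k] n)

/-- A `k`-linear map on `A ⊗[k] N` that is `B`-balanced descends to `A ⊗_B N`. -/
def balLift {X : Type*} [AddCommGroup X] [Module k X] (f : A ⊗[k] N →ₗ[k] X)
    (hf : ∀ (a : A) (b : B) (n : N), f ((a * (b : A)) ⊗ₜ[k] n) = f (a ⊗ₜ[k] (b • n))) :
    BalTensor B N →ₗ[k] X :=
  Submodule.liftQ ((balancedRel B N).restrictScalars k) f (by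
    refine Submodule.span_le.2 ?_
    rintro x ⟨a, b, n, rfl⟩
    simp [hf]) ∘ₗ (Submodule.Quotient.restrictScalarsEquiv k (balancedRel B N)).symm.toLinearMap

end Balanced

section Slices

variable {k : Type v} {H : Type u} [Field k] [Ring H] [HopfAlgebra k H]
  {X : Type u} [AddCommGroup X] [Module k X]

/-- `x ⊗ h ↦ φ(h) x`. -/
def slice (X : Type u) [AddCommGroup X] [Module k X] (φ : H →ₗ[k] k) : X ⊗[k] H →ₗ[k] X :=
  (TensorProduct.rid k X).toLinearMap ∘ₗ φ.lTensor X

theorem slice_tmul (φ : H →ₗ[k] k) (x : X) (h : H) : slice X φ (x ⊗ₜ[k] h) = φ h • x := by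
  simp [slice]

theorem slice_ext {x y : X ⊗[k] H} (hxy : ∀ φ : H →ₗ[k] k, slice X φ x = slice X φ y) :
    x = y := by
  classical
  apply (TensorProduct.equivFinsuppOfBasisRight (Module.Basis.ofVectorSpace k H)).injective
  ext i
  rw [TensorProduct.equivFinsuppOfBasisRight_apply, TensorProduct.equivFinsuppOfBasisRight_apply]
  exact hxy _

theorem exists_of_slice_mem (K : Submodule k X) (x : X ⊗[k] H)
    (hx : ∀ φ : H →ₗ[k] k, slice X φ x ∈ K) : ∃ y : K ⊗[k] H, K.subtype.rTensor H y = x := by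
  classical
  set b := Module.Basis.ofVectorSpace k H
  set e := TensorProduct.equivFinsuppOfBasisRight (M := X) b with he
  have h1 : x = (e x).sum fun i m => m ⊗ₜ[k] b i := by
    rw [← TensorProduct.equivFinsuppOfBasisRight_symm_apply, LinearEquiv.symm_apply_apply]
  have h2 : x ∈ LinearMap.range (K.subtype.rTensor H) := by
    rw [h1]
    refine Submodule.sum_mem _ fun i _ => ⟨(⟨e x i, ?_⟩ : K) ⊗ₜ[k] b i, by simp⟩
    rw [he, TensorProduct.equivFinsuppOfBasisRight_apply]
    exact hx _
  exact h2

theorem slice_rTensor {Y : Type u} [AddCommGroup Y] [Module k Y] (φ : H →ₗ[k] k)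
    (f : X →ₗ[k] Y) (x : X ⊗[k] H) : slice Y φ (f.rTensor H x) = f (slice X φ x) := by
  induction x with
  | zero => simp
  | tmul x h => simp [slice_tmul]
  | add x y hx hy => simp [hx, hy]

/-- `h ↦ h₍₁₎ φ(h₍₂₎)`. -/
def dslice (φ : H →ₗ[k] k) : H →ₗ[k] H := slice H φ ∘ₗ comul

theorem slice_mul (φ : H →ₗ[k] k) (g : H) (y : H ⊗[k] H) :
    slice H φ ((g ⊗ₜ[k] (1 : H)) * y) = g * slice H φ y := by
  induction y with
  | zero => simp
  | tmul x h => simp [slice_tmul]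
  | add x y hx hy => simp [mul_add, hx, hy]

theorem slice_assoc_symm (φ : H →ₗ[k] k) (y : X ⊗[k] (H ⊗[k] H)) :
    slice (X ⊗[k] H) φ ((TensorProduct.assoc k X H H).symm y) = (slice H φ).lTensor X y := by
  induction y with
  | zero => simp
  | tmul x h =>
    induction h with
    | zero => simp
    | tmul g h => simp [slice_tmul]
    | add x y hx hy => simp only [TensorProduct.tmul_add, map_add, hx, hy]
  | add x y hx hy => simp only [map_add, hx, hy]

theorem dslice_apply (φ : H →ₗ[k] k) (h : H) : dslice φ h = slice H φ (comul h) := rfl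

variable {P : Type u} [AddCommGroup P] [Module k P] [RightComodule k H P]

theorem coassoc_apply (p : P) :
    TensorProduct.assoc k P H H ((coact (k := k) (H := H)).rTensor H (coact p)) =
      (comul (R := k) (A := H)).lTensor P (coact p) :=
  LinearMap.congr_fun (RightComodule.coassoc (k := k) (H := H) (P := P)) p

theorem slice_counit_coact (p : P) : slice P (counit (R := k) (A := H)) (coact p) = p :=
  LinearMap.congr_fun (RightComodule.counit_coact (k := k) (H := H) (P := P)) p

end Slices

section Span

variable {k : Type v} {H : Type u} [Field k] [Ring H] [HopfAlgebra k H] [HasBijectiveAntipode k H]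

/-- The inverse of the antipode. -/
def antipodeInv (k : Type v) (H : Type u) [Field k] [Ring H] [HopfAlgebra k H]
    [HasBijectiveAntipode k H] : H →ₗ[k] H :=
  (LinearEquiv.ofBijective (antipode k : H →ₗ[k] H)
    HasBijectiveAntipode.bijective).symm.toLinearMap

theorem antipode_antipodeInv (h : H) : antipode k (antipodeInv k H h) = h :=
  (LinearEquiv.ofBijective (antipode k : H →ₗ[k] H)
    HasBijectiveAntipode.bijective).apply_symm_apply h

/-- `x ⊗ y ↦ S⁻¹(y) x`. -/
def twist (k : Type v) (H : Type u) [Field k] [Ring H] [HopfAlgebra k H]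
    [HasBijectiveAntipode k H] : H ⊗[k] H →ₗ[k] H :=
  TensorProduct.lift ((LinearMap.mul k H).flip.compl₂ (antipodeInv k H))

theorem twist_tmul (x y : H) : twist k H (x ⊗ₜ[k] y) = antipodeInv k H y * x := by
  simp [twist]

theorem twist_comul (h : H) : twist k H (comul (R := k) h) = algebraMap k H (counit h) := by
  apply (HasBijectiveAntipode.bijective (k := k) (H := H)).injective
  have h1 : (antipode k : H →ₗ[k] H) ∘ₗ twist k H =
      LinearMap.mul' k H ∘ₗ (antipode k : H →ₗ[k] H).rTensor H := by
    ext x y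
    simp [twist_tmul, antipode_mul_antidistrib, antipode_antipodeInv]
  have h2 := LinearMap.congr_fun h1 (comul (R := k) h)
  simp only [LinearMap.comp_apply] at h2
  rw [h2, mul_antipode_rTensor_comul_apply, Algebra.algebraMap_eq_smul_one, map_smul, antipode_one]

variable {P : Type u} [AddCommGroup P] [Module k P] [RightComodule k H P]

/-- Two linear maps on `P ⊗ H` that agree on all `p₍₀₎ ⊗ h p₍₁₎` are equal. -/
theorem eq_of_eq_on_coact {X : Type*} [AddCommGroup X] [Module k X] (F G : P ⊗[k] H →ₗ[k] X)
    (hFG : ∀ (h : H) (p : P), F ((LinearMap.mulLeft k h).lTensor P (coact p)) =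
      G ((LinearMap.mulLeft k h).lTensor P (coact p))) : F = G := by
  have key : ∀ p : P, (twist k H).lTensor P (TensorProduct.assoc k P H H
      ((coact (k := k) (H := H)).rTensor H (coact p))) = p ⊗ₜ[k] (1 : H) := by
    intro p
    rw [coassoc_apply, ← LinearMap.comp_apply, ← LinearMap.lTensor_comp]
    have : twist k H ∘ₗ comul = Algebra.linearMap k H ∘ₗ counit := by
      ext h; simp [twist_comul]
    rw [this]
    conv_rhs => rw [← slice_counit_coact (k := k) (H := H) p]
    generalize (coact p : P ⊗[k] H) = x
    induction x with
    | zero => simp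
    | tmul x h =>
      simp [slice_tmul, Algebra.algebraMap_eq_smul_one, TensorProduct.smul_tmul]
    | add x y hx hy => simp [TensorProduct.add_tmul, hx, hy]
  have main : ∀ (h : H) (y : P ⊗[k] H),
      F ((LinearMap.mulLeft k h).lTensor P ((twist k H).lTensor P (TensorProduct.assoc k P H H
        ((coact (k := k) (H := H)).rTensor H y)))) =
      G ((LinearMap.mulLeft k h).lTensor P ((twist k H).lTensor P (TensorProduct.assoc k P H H
        ((coact (k := k) (H := H)).rTensor H y)))) := by
    intro h y
    induction y with
    | zero => simp
    | tmul p g =>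
      have : (LinearMap.mulLeft k h).lTensor P ((twist k H).lTensor P (TensorProduct.assoc k P H H
        ((coact (k := k) (H := H)).rTensor H (p ⊗ₜ[k] g)))) =
          (LinearMap.mulLeft k (h * antipodeInv k H g)).lTensor P (coact p) := by
        rw [LinearMap.rTensor_tmul]
        generalize (coact p : P ⊗[k] H) = x
        induction x with
        | zero => simp
        | tmul x h => simp [twist_tmul]
        | add x y hx hy => simp only [map_add, TensorProduct.add_tmul, hx, hy]
      rw [this, hFG]
    | add x y hx hy => simp only [map_add, hx, hy]
  ext p h
  have := main h (coact p)
  rw [key] at this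
  simpa using this

end Span

section Rational

variable {k : Type v} {A : Type u} [Field k] [Ring A] [Algebra k A]
  (P : Type u) [AddCommGroup P] [Module k P] [Module A P] [IsScalarTower k A P]

/-- The right action of `End_A(P)ᵒᵖ ⊗ G` on `P ⊗ G`:  `(p ⊗ g') · (f ⊗ g) = f(p) ⊗ g' g`. -/
def tensorAct (A : Type u) [Ring A] [Algebra k A]
    (P : Type u) [AddCommGroup P] [Module k P] [Module A P] [IsScalarTower k A P]
    (G : Type u) [Ring G] [Algebra k G] :
    (Module.End A P)ᵐᵒᵖ ⊗[k] G →ₗ[k] Module.End k (P ⊗[k] G) :=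
  TensorProduct.lift
    (((TensorProduct.mapBilinear (RingHom.id k) P G P G).compl₂ (LinearMap.mul k G).flip) ∘ₗ
      (LinearMap.restrictScalarsₗ k A P P k) ∘ₗ (opLinearEquiv k).symm.toLinearMap)

variable {P}

theorem tensorAct_tmul (G : Type u) [Ring G] [Algebra k G] (f : (Module.End A P)ᵐᵒᵖ) (g : G)
    (p : P) (g' : G) :
    tensorAct A P G (f ⊗ₜ[k] g) (p ⊗ₜ[k] g') = (f.unop p) ⊗ₜ[k] (g' * g) := by
  simp [tensorAct]


theorem tensorAct_mul (G : Type u) [Ring G] [Algebra k G]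
    (z w : (Module.End A P)ᵐᵒᵖ ⊗[k] G) :
    tensorAct A P G (z * w) = tensorAct A P G w * tensorAct A P G z := by
  induction z with
  | zero => simp
  | add x y hx hy => simp only [add_mul, mul_add, map_add, hx, hy]
  | tmul f g =>
    induction w with
    | zero => simp
    | add x y hx hy => simp only [add_mul, mul_add, map_add, hx, hy]
    | tmul f' g' =>
      ext p h
      simp [tensorAct_tmul, mul_assoc]

theorem tensorAct_mulLeft (G : Type u) [Ring G] [Algebra k G]
    (z : (Module.End A P)ᵐᵒᵖ ⊗[k] G) (g : G) (x : P ⊗[k] G) :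
    tensorAct A P G z ((LinearMap.mulLeft k g).lTensor P x) =
      (LinearMap.mulLeft k g).lTensor P (tensorAct A P G z x) := by
  induction z with
  | zero => simp
  | add z w hz hw => simp only [map_add, LinearMap.add_apply, hz, hw]
  | tmul f h =>
    induction x with
    | zero => simp
    | add x y hx hy => simp only [map_add, hx, hy]
    | tmul p h' => simp [tensorAct_tmul, mul_assoc]

theorem tensorAct_map {G G' : Type u} [Ring G] [Algebra k G] [Ring G'] [Algebra k G']
    (θ : G →ₐ[k] G') (z : (Module.End A P)ᵐᵒᵖ ⊗[k] G) (x : P ⊗[k] G) :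
    tensorAct A P G' (θ.toLinearMap.lTensor _ z) (θ.toLinearMap.lTensor P x) =
      θ.toLinearMap.lTensor P (tensorAct A P G z x) := by
  induction z with
  | zero => simp
  | add z w hz hw => simp only [map_add, LinearMap.add_apply, hz, hw]
  | tmul f h =>
    induction x with
    | zero => simp
    | add x y hx hy => simp only [map_add, hx, hy]
    | tmul p h' => simp [tensorAct_tmul]

variable {H : Type u} [Ring H] [HopfAlgebra k H]

theorem slice_tensorAct_one (z : (Module.End A P)ᵐᵒᵖ ⊗[k] H) (φ : H →ₗ[k] k) (p : P) :
    slice P φ (tensorAct A P H z (p ⊗ₜ[k] (1 : H))) = (slice _ φ z).unop p := by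
  induction z with
  | zero => simp
  | add z w hz hw => simp only [map_add, LinearMap.add_apply, hz, hw, unop_add]
  | tmul f h => simp [tensorAct_tmul, slice_tmul]

theorem slice_counit_tensorAct (z : (Module.End A P)ᵐᵒᵖ ⊗[k] H) (x : P ⊗[k] H) :
    slice P counit (tensorAct A P H z x) = (slice _ counit z).unop (slice P counit x) := by
  induction z with
  | zero => simp
  | add z w hz hw => simp only [map_add, LinearMap.add_apply, hz, hw, unop_add]
  | tmul f h =>
    induction x with
    | zero => simp
    | add x y hx hy => simp only [map_add, hx, hy]
    | tmul p h' => simp [tensorAct_tmul, slice_tmul, mul_comm, mul_smul]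

variable [RightComodule k H P]

/-- `z = f₍₀₎ ⊗ f₍₁₎` witnesses that the `A`-endomorphism `f` of `P` is rational:
`ρ(f(p)) = f₍₀₎(p₍₀₎) ⊗ p₍₁₎ f₍₁₎` for all `p`. -/
def IsRationalWith (f : (Module.End A P)ᵐᵒᵖ) (z : (Module.End A P)ᵐᵒᵖ ⊗[k] H) : Prop :=
  ∀ p : P, coact (f.unop p) = tensorAct A P H z (coact p)

theorem IsRationalWith.add {f f' : (Module.End A P)ᵐᵒᵖ} {z z' : (Module.End A P)ᵐᵒᵖ ⊗[k] H}
    (h : IsRationalWith f z) (h' : IsRationalWith f' z') : IsRationalWith (f + f') (z + z') := by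
  intro p
  rw [unop_add, LinearMap.add_apply, map_add, map_add, LinearMap.add_apply, h, h']

theorem IsRationalWith.mul {f f' : (Module.End A P)ᵐᵒᵖ} {z z' : (Module.End A P)ᵐᵒᵖ ⊗[k] H}
    (h : IsRationalWith f z) (h' : IsRationalWith f' z') : IsRationalWith (f * f') (z * z') := by
  intro p
  rw [unop_mul, Module.End.mul_apply, h', h, tensorAct_mul, Module.End.mul_apply]

theorem IsRationalWith.smul {f : (Module.End A P)ᵐᵒᵖ} {z : (Module.End A P)ᵐᵒᵖ ⊗[k] H}
    (r : k) (h : IsRationalWith f z) : IsRationalWith (r • f) (r • z) := by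
  intro p
  rw [unop_smul, LinearMap.smul_apply, map_smul, map_smul, LinearMap.smul_apply, h]

theorem IsRationalWith.one :
    IsRationalWith (H := H) (1 : (Module.End A P)ᵐᵒᵖ) (1 : (Module.End A P)ᵐᵒᵖ ⊗[k] H) := by
  intro p
  have : tensorAct (k := k) A P H 1 = 1 := by
    ext p h
    simp [Algebra.TensorProduct.one_def, tensorAct_tmul]
  rw [this]
  simp

variable (k A P H) in
/-- `E = END_A(P)ᵒᵖ`, the algebra of rational `A`-endomorphisms of `P`, with the multiplication
opposite to composition. -/
def RationalEnd : Subalgebra k (Module.End A P)ᵐᵒᵖ where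
  carrier := {f | ∃ z : (Module.End A P)ᵐᵒᵖ ⊗[k] H, IsRationalWith f z}
  mul_mem' := fun ⟨_, h⟩ ⟨_, h'⟩ => ⟨_, h.mul h'⟩
  add_mem' := fun ⟨_, h⟩ ⟨_, h'⟩ => ⟨_, h.add h'⟩
  algebraMap_mem' := by
    intro r
    rw [Algebra.algebraMap_eq_smul_one]
    exact ⟨_, IsRationalWith.one.smul r⟩

variable [HasBijectiveAntipode k H]

theorem IsRationalWith.unique {f : (Module.End A P)ᵐᵒᵖ} {z z' : (Module.End A P)ᵐᵒᵖ ⊗[k] H}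
    (h : IsRationalWith f z) (h' : IsRationalWith f z') : z = z' := by
  have : tensorAct A P H z = tensorAct A P H z' :=
    eq_of_eq_on_coact _ _ fun g p => by
      rw [tensorAct_mulLeft, tensorAct_mulLeft, ← h, ← h']
  refine slice_ext fun φ => unop_injective (LinearMap.ext fun p => ?_)
  rw [← slice_tensorAct_one, ← slice_tensorAct_one, this]

theorem IsRationalWith.slice {f : (Module.End A P)ᵐᵒᵖ} {z : (Module.End A P)ᵐᵒᵖ ⊗[k] H}
    (h : IsRationalWith f z) (φ : H →ₗ[k] k) :
    IsRationalWith (slice _ φ z) ((dslice φ).lTensor _ z) := by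
  have key : (TensorProduct.assoc k P H H).toLinearMap ∘ₗ (coact (k := k) (H := H)).rTensor H ∘ₗ
      tensorAct A P H z =
      tensorAct A P (H ⊗[k] H) ((comul (R := k) (A := H)).lTensor _ z) ∘ₗ
        (TensorProduct.assoc k P H H).toLinearMap ∘ₗ (coact (k := k) (H := H)).rTensor H := by
    have aux : ∀ (g : H) (y : P ⊗[k] H), TensorProduct.assoc k P H H
        ((coact (k := k) (H := H)).rTensor H ((LinearMap.mulLeft k g).lTensor P y)) =
        (LinearMap.mulLeft k ((1 : H) ⊗ₜ[k] g)).lTensor P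
          (TensorProduct.assoc k P H H ((coact (k := k) (H := H)).rTensor H y)) := by
      intro g y
      induction y with
      | zero => simp
      | add x y hx hy => simp only [map_add, hx, hy]
      | tmul p h' =>
        simp only [LinearMap.lTensor_tmul, LinearMap.rTensor_tmul, LinearMap.mulLeft_apply]
        generalize (coact p : P ⊗[k] H) = x
        induction x with
        | zero => simp
        | add x y hx hy => simp only [map_add, TensorProduct.add_tmul, hx, hy]
        | tmul p h' => simp
    refine eq_of_eq_on_coact _ _ fun g p => ?_
    simp only [LinearMap.comp_apply, LinearEquiv.coe_coe]
    rw [tensorAct_mulLeft, aux, aux, tensorAct_mulLeft, ← h, coassoc_apply, coassoc_apply, h]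
    exact congrArg _ (tensorAct_map (Bialgebra.comulAlgHom k H) z (coact p)).symm
  intro p
  have h1 := congrArg ((HopfLifting.slice H φ).lTensor P)
    (LinearMap.congr_fun key (p ⊗ₜ[k] (1 : H)))
  simp only [LinearMap.comp_apply, LinearEquiv.coe_coe, LinearMap.rTensor_tmul] at h1
  have h2 : ∀ z : (Module.End A P)ᵐᵒᵖ ⊗[k] H, (HopfLifting.slice H φ).lTensor P
      (TensorProduct.assoc k P H H ((coact (k := k) (H := H)).rTensor H
        (tensorAct A P H z (p ⊗ₜ[k] (1 : H))))) =
      coact ((HopfLifting.slice _ φ z).unop p) := by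
    intro z
    rw [← slice_assoc_symm, LinearEquiv.symm_apply_apply, slice_rTensor, slice_tensorAct_one]
  have h3 : ∀ (z : (Module.End A P)ᵐᵒᵖ ⊗[k] H) (x : P ⊗[k] H),
      (HopfLifting.slice H φ).lTensor P
        (tensorAct A P (H ⊗[k] H) ((comul (R := k) (A := H)).lTensor _ z)
          (TensorProduct.assoc k P H H (x ⊗ₜ[k] (1 : H)))) =
      tensorAct A P H ((dslice φ).lTensor _ z) x := by
    intro z x
    induction z with
    | zero => simp
    | add z w hz hw => simp only [map_add, LinearMap.add_apply, hz, hw]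
    | tmul f h =>
      induction x with
      | zero => simp
      | add x y hx hy => simp only [map_add, TensorProduct.add_tmul, hx, hy]
      | tmul p h' => simp [tensorAct_tmul, slice_mul, dslice_apply]
  rw [h2, h3] at h1
  exact h1

theorem exists_coact_rationalEnd (f : RationalEnd k A P H) :
    ∃ y : RationalEnd k A P H ⊗[k] H,
      IsRationalWith f.1 ((RationalEnd k A P H).val.toLinearMap.rTensor H y) := by
  obtain ⟨z, hz⟩ := f.2
  obtain ⟨y, hy⟩ := exists_of_slice_mem (Subalgebra.toSubmodule (RationalEnd k A P H)) z
    fun φ => ⟨_, hz.slice φ⟩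
  refine ⟨y, ?_⟩
  have : (RationalEnd k A P H).val.toLinearMap.rTensor H y = z := hy
  rwa [this]

theorem rTensor_val_injective :
    Function.Injective ((RationalEnd k A P H).val.toLinearMap.rTensor H) :=
  Module.Flat.rTensor_preserves_injective_linearMap (RationalEnd k A P H).val.toLinearMap
    Subtype.val_injective

theorem coact_rationalEnd_eq {f : RationalEnd k A P H} {y : RationalEnd k A P H ⊗[k] H}
    (hy : IsRationalWith f.1 ((RationalEnd k A P H).val.toLinearMap.rTensor H y)) :
    (exists_coact_rationalEnd f).choose = y :=
  rTensor_val_injective ((exists_coact_rationalEnd f).choose_spec.unique hy)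

/-- The coaction `f ↦ f₍₀₎ ⊗ f₍₁₎` on the rational endomorphisms. -/
def rationalCoact : RationalEnd k A P H →ₗ[k] RationalEnd k A P H ⊗[k] H where
  toFun f := (exists_coact_rationalEnd f).choose
  map_add' f g := coact_rationalEnd_eq (by
    rw [map_add]
    exact (exists_coact_rationalEnd f).choose_spec.add (exists_coact_rationalEnd g).choose_spec)
  map_smul' r f := coact_rationalEnd_eq (by
    rw [map_smul]
    exact (exists_coact_rationalEnd f).choose_spec.smul r)

theorem rationalCoact_spec (f : RationalEnd k A P H) :
    IsRationalWith f.1 ((RationalEnd k A P H).val.toLinearMap.rTensor H (rationalCoact f)) :=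
  (exists_coact_rationalEnd f).choose_spec

theorem rationalCoact_eq {f : RationalEnd k A P H} {y : RationalEnd k A P H ⊗[k] H}
    (hy : IsRationalWith f.1 ((RationalEnd k A P H).val.toLinearMap.rTensor H y)) :
    rationalCoact f = y := coact_rationalEnd_eq hy

theorem rTensor_val_mul (y y' : RationalEnd k A P H ⊗[k] H) :
    (RationalEnd k A P H).val.toLinearMap.rTensor H (y * y') =
      (RationalEnd k A P H).val.toLinearMap.rTensor H y *
        (RationalEnd k A P H).val.toLinearMap.rTensor H y' :=
  map_mul (Algebra.TensorProduct.map (RationalEnd k A P H).val (AlgHom.id k H)) y y'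

/-- `END_A(P)ᵒᵖ` is a right `H`-comodule algebra. -/
instance rationalEndComoduleAlgebra : RightComoduleAlgebra k H (RationalEnd k A P H) where
  coact := rationalCoact
  coassoc := by
    refine LinearMap.ext fun f => ?_
    simp only [LinearMap.comp_apply, LinearEquiv.coe_coe]
    apply (TensorProduct.assoc k (RationalEnd k A P H) H H).symm.injective
    refine slice_ext (k := k) (H := H) (X := RationalEnd k A P H ⊗[k] H) fun φ => ?_
    rw [LinearEquiv.symm_apply_apply, slice_rTensor, slice_assoc_symm]
    have e : (slice H φ).lTensor (RationalEnd k A P H)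
        ((comul (R := k) (A := H)).lTensor (RationalEnd k A P H) (rationalCoact f)) =
        (dslice φ).lTensor (RationalEnd k A P H) (rationalCoact f) := by
      rw [← LinearMap.comp_apply, ← LinearMap.lTensor_comp]
      rfl
    rw [e]
    apply rationalCoact_eq
    have h := (rationalCoact_spec f).slice φ
    rw [slice_rTensor] at h
    rw [← LinearMap.comp_apply (LinearMap.lTensor _ _), LinearMap.lTensor_comp_rTensor,
      ← LinearMap.rTensor_comp_lTensor] at h
    exact h
  counit_coact := by
    refine LinearMap.ext fun f => ?_
    apply Subtype.val_injective
    apply unop_injective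
    ext p
    have h := congrArg (slice P (counit (R := k) (A := H))) (rationalCoact_spec f p)
    rw [slice_counit_tensorAct, slice_counit_coact, slice_counit_coact, slice_rTensor] at h
    exact h.symm
  coact_one := rationalCoact_eq (by
    have : (RationalEnd k A P H).val.toLinearMap.rTensor H 1 = 1 :=
      map_one (Algebra.TensorProduct.map (RationalEnd k A P H).val (AlgHom.id k H))
    rw [this]
    exact IsRationalWith.one)
  coact_mul f g := rationalCoact_eq (by
    rw [rTensor_val_mul]
    exact (rationalCoact_spec f).mul (rationalCoact_spec g))

end Rational

section Extension

variable (k : Type v) (H A : Type u) [Field k] [Ring H] [HopfAlgebra k H]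
  [Ring A] [Algebra k A] [RightComoduleAlgebra k H A]

/-- The map `a ⊗_B b ↦ a₍₀₎ b ⊗ a₍₁₎` from `A ⊗_B A` to `A ⊗ H`, where `B = A^{co H}`. -/
def canonicalMap : BalTensor (coinvariants k H A) A →ₗ[k] A ⊗[k] H :=
  balLift (coinvariants k H A)
    (LinearMap.mul' k (A ⊗[k] H) ∘ₗ
      TensorProduct.map (coact (k := k) (H := H))
        (Algebra.TensorProduct.includeLeft : A →ₐ[k] A ⊗[k] H).toLinearMap)
    (by
      intro a b c
      have hb : coact (b : A) = (b : A) ⊗ₜ[k] (1 : H) := b.2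
      simp [RightComoduleAlgebra.coact_mul, hb, mul_assoc, Subalgebra.smul_def])

variable {k A} in
/-- The map `A ⊗_B f` induced by a left `B`-linear map `f`. -/
def balMap (B : Subalgebra k A) {N N' : Type u}
    [AddCommGroup N] [Module k N] [Module B N] [IsScalarTower k B N]
    [AddCommGroup N'] [Module k N'] [Module B N'] [IsScalarTower k B N'] (f : N →ₗ[B] N') :
    BalTensor B N →ₗ[k] BalTensor B N' :=
  balLift B (((balancedRel B N').mkQ.restrictScalars k) ∘ₗ (f.restrictScalars k).lTensor A) (by
    intro a b n
    simp only [LinearMap.comp_apply, LinearMap.lTensor_tmul, LinearMap.restrictScalars_apply,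
      map_smul, Submodule.mkQ_apply]
    rw [Submodule.Quotient.eq]
    exact Submodule.subset_span ⟨a, b, f n, rfl⟩)

/-- `A` is faithfully flat as a right module over the subalgebra `B`: the functor `A ⊗_B -` on
left `B`-modules preserves injections and kills no nonzero module. -/
structure RightFaithfullyFlat {k : Type v} {A : Type u} [Field k] [Ring A] [Algebra k A]
    (B : Subalgebra k A) : Prop where
  flat : ∀ (N N' : Type u) [AddCommGroup N] [Module k N] [Module B N] [IsScalarTower k B N]
    [AddCommGroup N'] [Module k N'] [Module B N'] [IsScalarTower k B N'] (f : N →ₗ[B] N'),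
    Function.Injective f → Function.Injective (balMap B f)
  faithful : ∀ (N : Type u) [AddCommGroup N] [Module k N] [Module B N] [IsScalarTower k B N],
    Subsingleton (BalTensor B N) → Subsingleton N

/-- `A` is a faithfully flat `H`-Galois extension of `A^{co H}`. -/
structure IsFaithfullyFlatGalois : Prop where
  galois : Function.Bijective (canonicalMap k H A)
  faithfullyFlat : RightFaithfullyFlat (coinvariants k H A)

variable (M : Type u) [AddCommGroup M] [Module k M] [Module (coinvariants k H A) M]
  [IsScalarTower k (coinvariants k H A) M]

/-- `a ↦ a ⊗_B m`, linear in `m` as well. -/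
def btmulLin : M →ₗ[k] A →ₗ[k] BalTensor (coinvariants k H A) M :=
  ((TensorProduct.mk k A M).compr₂
    ((balancedRel (coinvariants k H A) M).mkQ.restrictScalars k)).flip

/-- The coaction `a ⊗_B m ↦ (a₍₀₎ ⊗_B m) ⊗ a₍₁₎` on `A ⊗_B M`. -/
def inducedCoact : BalTensor (coinvariants k H A) M →ₗ[k]
    BalTensor (coinvariants k H A) M ⊗[k] H :=
  balLift (coinvariants k H A)
    (TensorProduct.lift (((LinearMap.rTensorHom H ∘ₗ btmulLin k H A M).flip) ∘ₗ
      coact (k := k) (H := H)))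
    (by
      intro a b m
      have hb : coact (b : A) = (b : A) ⊗ₜ[k] (1 : H) := b.2
      simp only [TensorProduct.lift.tmul, LinearMap.comp_apply, LinearMap.flip_apply,
        LinearMap.coe_rTensorHom, RightComoduleAlgebra.coact_mul, hb]
      generalize (coact a : A ⊗[k] H) = x
      induction x with
      | zero => simp
      | add x y hx hy => simp only [add_mul, map_add, hx, hy]
      | tmul c h =>
        rw [Algebra.TensorProduct.tmul_mul_tmul, mul_one, LinearMap.rTensor_tmul,
          LinearMap.rTensor_tmul]
        congr 1
        exact (Submodule.Quotient.eq _).2 (Submodule.subset_span ⟨c, b, m, rfl⟩))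

variable {M}

theorem inducedCoact_btmul (a : A) (m : M) :
    inducedCoact k H A M (btmul (coinvariants k H A) a m) =
      (btmulLin k H A M m).rTensor H (coact a) := rfl

theorem balTensor_induction {motive : BalTensor (coinvariants k H A) M → Prop}
    (btmul : ∀ a m, motive (btmul (coinvariants k H A) a m)) (zero : motive 0)
    (add : ∀ x y, motive x → motive y → motive (x + y)) (x) : motive x := by
  obtain ⟨y, rfl⟩ := Submodule.Quotient.mk_surjective _ x
  induction y with
  | zero => exact zero
  | add x y hx hy => exact add _ _ hx hy
  | tmul a m => exact btmul a m

variable (M)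

/-- `A ⊗_B M` is a right `H`-comodule. -/
instance balTensorComodule : RightComodule k H (BalTensor (coinvariants k H A) M) where
  coact := inducedCoact k H A M
  coassoc := by
    refine LinearMap.ext fun x => ?_
    simp only [LinearMap.comp_apply, LinearEquiv.coe_coe]
    induction x using balTensor_induction with
    | zero => simp
    | add x y hx hy => simp only [map_add, hx, hy]
    | btmul a m =>
      rw [inducedCoact_btmul]
      have h1 : inducedCoact k H A M ∘ₗ btmulLin k H A M m =
          (btmulLin k H A M m).rTensor H ∘ₗ coact (k := k) (H := H) := rfl
      rw [← LinearMap.comp_apply (LinearMap.rTensor _ _) (LinearMap.rTensor _ _),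
        ← LinearMap.rTensor_comp, h1, LinearMap.rTensor_comp, LinearMap.comp_apply]
      have h2 : ∀ y : (A ⊗[k] H) ⊗[k] H, TensorProduct.assoc k _ H H
          (((btmulLin k H A M m).rTensor H).rTensor H y) =
          (btmulLin k H A M m).rTensor (H ⊗[k] H) (TensorProduct.assoc k A H H y) := by
        intro y
        induction y with
        | zero => simp
        | add x y hx hy => simp only [map_add, hx, hy]
        | tmul x h =>
          induction x with
          | zero => simp
          | add x y hx hy => simp only [map_add, TensorProduct.add_tmul, hx, hy]
          | tmul a h => simp
      rw [h2, coassoc_apply, ← LinearMap.comp_apply, LinearMap.rTensor_comp_lTensor,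
        ← LinearMap.lTensor_comp_rTensor, LinearMap.comp_apply]
  counit_coact := by
    refine LinearMap.ext fun x => ?_
    change slice _ counit (inducedCoact k H A M x) = x
    induction x using balTensor_induction with
    | zero => simp
    | add x y hx hy => simp only [map_add, hx, hy]
    | btmul a m =>
      rw [inducedCoact_btmul, slice_rTensor, slice_counit_coact]
      rfl

/-- `E = END_A(A ⊗_B M)ᵒᵖ`. -/
abbrev LiftAlgebra : Subalgebra k (Module.End A (BalTensor (coinvariants k H A) M))ᵐᵒᵖ :=
  RationalEnd k A (BalTensor (coinvariants k H A) M) H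

variable {M} in
/-- An action `A × M → M` restricts to the given `B`-module structure of `M`. -/
def ExtendsAction (act : A → M → M) : Prop :=
  ∀ (b : coinvariants k H A) (m : M), act (b : A) m = b • m

/-- A left `A`-module structure on `M` that extends the given `B`-module structure. -/
structure ModuleExtension where
  toModule : Module A M
  extendsAction : ExtendsAction k H A (fun (a : A) (m : M) => a • m)

variable {k H A M} in
/-- The action of `a` on `m` in the module structure `s`. -/
def ModuleExtension.act (s : ModuleExtension k H A M) (a : A) (m : M) : M :=
  letI := s.toModule; a • m

/-- Two `A`-module structures on `M` are equivalent if they give isomorphic `A`-modules. -/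
def extensionSetoid : Setoid (ModuleExtension k H A M) where
  r s₁ s₂ := ∃ f : M ≃+ M, ∀ (a : A) (m : M), f (s₁.act a m) = s₂.act a (f m)
  iseqv := by
    refine ⟨fun s => ⟨AddEquiv.refl M, fun _ _ => rfl⟩, ?_, ?_⟩
    · rintro s₁ s₂ ⟨f, hf⟩
      exact ⟨f.symm, fun a m => by rw [AddEquiv.symm_apply_eq, hf, AddEquiv.apply_symm_apply]⟩
    · rintro s₁ s₂ s₃ ⟨f, hf⟩ ⟨g, hg⟩
      exact ⟨f.trans g, fun a m => by simp [hf, hg]⟩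

/-- Isomorphism classes of left `A`-module structures on `M` extending the `B`-module
structure. -/
def ExtensionClasses : Type u := Quotient (extensionSetoid k H A M)

variable {k H A M}

/-- `t(S(a₍₁₎))(a₍₀₎ ⊗_B m)` for a linear map `t : H → E`. -/
def antipodeEval (t : H →ₗ[k] LiftAlgebra k H A M) (a : A) (m : M) :
    BalTensor (coinvariants k H A) M :=
  TensorProduct.lift
    ((LinearMap.restrictScalarsₗ k A _ _ k ∘ₗ (opLinearEquiv k).symm.toLinearMap ∘ₗ
      (LiftAlgebra k H A M).val.toLinearMap ∘ₗ t ∘ₗ antipode k).flip ∘ₗ btmulLin k H A M m)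
    (coact a)

end Extension

end HopfLifting

end

/-! Write `P = A ⊗_B M`. The correspondence is already bijective before passing to classes, between
module structures and elements of `Ω_E`. From structures to maps: if `A` acts on `M`, the Galois
property makes `a ⊗ m ↦ a₍₀₎m ⊗ a₍₁₎` an isomorphism `P ≃ M ⊗ H` (`galoisMap_injective`,
`galoisMap_surjective`), colinear and linear for the diagonal action of `A`. Right multiplication by
`h` on `H` commutes with that action; transported to `P` it is `t(h)`. It is multiplicative because
`E` carries the opposite product, and colinear because `Δ` is multiplicative. The required formula
becomes `a₍₀₎m ⊗ a₍₁₎S(a₍₂₎) = am ⊗ 1` (`translation_corresponds`). From maps to structures: for `t`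
in `Ω_E`, the element `t(S(a₍₁₎))(a₍₀₎ ⊗ m)` is coinvariant (`inducedCoact_antipodeEval`).
Faithfully flat descent identifies `M` with the coinvariants of `P` via `m ↦ 1 ⊗ m`
(`one_btmul_injective`, `exists_one_btmul_eq`), so the element is `1 ⊗ am` for a unique `am`, and
this defines an action (`exists_moduleExtension`). The two passages are mutually inverse: the
formula determines the action by injectivity of `m ↦ 1 ⊗ m`, and it determines `t` because it forces
`m ⊗ h ↦ t(h)(1 ⊗ m)` to be the inverse of the Galois isomorphism (`evalOne_galoisMap`,
`Corresponds.algHom_unique`). For the equivalence relations: a coinvariant of `E` is a colinear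
endomorphism of `P`, so it restricts to `M`, while a `B`-linear `f` induces the coinvariant `A ⊗_B
f`. Units conjugating `t₁` into `t₂` thus match isomorphisms of the two `A`-modules. -/

noncomputable section

namespace HopfLifting

open RightComodule (coact)

/-! ### Convolution identities for the antipode. -/

section Antipode

open WithConv

variable {k : Type v} {H : Type u} [Field k] [Ring H] [HopfAlgebra k H]

/-- Composition with an algebra map preserves convolution, so `id * S = 1` in `End(H)` is carried to
`f * (f ∘ S) = 1`. -/
theorem toConv_algHom_mul_toConv_comp_antipode {R : Type*} [Ring R] [Algebra k R] (f : H →ₐ[k] R) :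
    toConv f.toLinearMap * toConv (f.toLinearMap ∘ₗ antipode k) = 1 := by
  have h := LinearMap.algHom_comp_convMul_distrib f (toConv (LinearMap.id : H →ₗ[k] H))
    (toConv (antipode k))
  rw [LinearMap.id_mul_antipode] at h
  refine Eq.trans ?_ (Eq.trans (congrArg toConv h.symm) ?_)
  · rfl
  · ext x
    simp

theorem toConv_comp_antipode_mul_toConv_algHom {R : Type*} [Ring R] [Algebra k R] (f : H →ₐ[k] R) :
    toConv (f.toLinearMap ∘ₗ antipode k) * toConv f.toLinearMap = 1 := by
  have h := LinearMap.algHom_comp_convMul_distrib f (toConv (antipode k))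
    (toConv (LinearMap.id : H →ₗ[k] H))
  rw [LinearMap.antipode_mul_id] at h
  refine Eq.trans ?_ (Eq.trans (congrArg toConv h.symm) ?_)
  · rfl
  · ext x
    simp

/-- `x ⊗ y ↦ (1 ⊗ x) Δ(S(y))`. -/
def mulComulAntipode (k : Type v) (H : Type u) [Field k] [Ring H] [HopfAlgebra k H] :
    H ⊗[k] H →ₗ[k] H ⊗[k] H :=
  LinearMap.mul' k (H ⊗[k] H) ∘ₗ TensorProduct.map
    (Algebra.TensorProduct.includeRight : H →ₐ[k] H ⊗[k] H).toLinearMap (comul ∘ₗ antipode k)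

theorem mulComulAntipode_tmul (x y : H) :
    mulComulAntipode k H (x ⊗ₜ[k] y) = ((1 : H) ⊗ₜ[k] x) * comul (antipode k y) := by
  simp [mulComulAntipode]

/-- `(1 ⊗ h₍₁₎) Δ(S(h₍₂₎)) = S(h) ⊗ 1`. -/
theorem mulComulAntipode_comul (h : H) :
    mulComulAntipode k H (comul h) = antipode k h ⊗ₜ[k] (1 : H) := by
  set i : H →ₐ[k] H ⊗[k] H := Algebra.TensorProduct.includeLeft
  set j : H →ₐ[k] H ⊗[k] H := Algebra.TensorProduct.includeRight
  set δ : H →ₐ[k] H ⊗[k] H := Bialgebra.comulAlgHom k H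
  -- In Sweedler form: `(x₍₁₎ ⊗ 1)(1 ⊗ x₍₂₎) = Δ(x)`. Cancelling `i` on the left and `δ` on the
  -- right turns `i * j = δ` into `j * δ⁻¹ = i⁻¹`, where inverses are composites with `S`.
  have hij : toConv i.toLinearMap * toConv j.toLinearMap = toConv δ.toLinearMap := by
    ext x
    change LinearMap.mul' k (H ⊗[k] H) (TensorProduct.map i.toLinearMap j.toLinearMap (comul x)) =
      comul x
    generalize (comul x : H ⊗[k] H) = y
    induction y with
    | zero => simp
    | tmul a b => simp [i, j]
    | add x y hx hy => simp only [map_add, hx, hy]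
  have key : toConv j.toLinearMap * toConv (δ.toLinearMap ∘ₗ antipode k) =
      toConv (i.toLinearMap ∘ₗ antipode k) := by
    rw [← one_mul (toConv j.toLinearMap * _), ← toConv_comp_antipode_mul_toConv_algHom i, mul_assoc,
      ← mul_assoc (toConv i.toLinearMap), hij, toConv_algHom_mul_toConv_comp_antipode, mul_one]
  exact LinearMap.congr_fun (congrArg ofConv key) h

end Antipode

/-! ### Calculus of pure tensors in `A ⊗_B N`. -/

section BalTensor

variable {k : Type v} {A : Type u} [Field k] [Ring A] [Algebra k A] {B : Subalgebra k A}
  {N : Type u} [AddCommGroup N] [Module k N] [Module B N] [IsScalarTower k B N]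
  {N' : Type u} [AddCommGroup N'] [Module k N'] [Module B N'] [IsScalarTower k B N']

theorem btmul_induction {motive : BalTensor B N → Prop}
    (btmul : ∀ a n, motive (btmul B a n)) (zero : motive 0)
    (add : ∀ x y, motive x → motive y → motive (x + y)) (x) : motive x := by
  obtain ⟨y, rfl⟩ := Submodule.Quotient.mk_surjective _ x
  induction y with
  | zero => exact zero
  | add x y hx hy => exact add _ _ hx hy
  | tmul a m => exact btmul a m

theorem btmul_mul_coe (a : A) (b : B) (n : N) : btmul B (a * (b : A)) n = btmul B a (b • n) :=
  (Submodule.Quotient.eq _).2 (Submodule.subset_span ⟨a, b, n, rfl⟩)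

theorem btmul_add (a : A) (n n' : N) : btmul B a (n + n') = btmul B a n + btmul B a n' := by
  simp [btmul, TensorProduct.tmul_add]

theorem btmul_zero (a : A) : btmul B a (0 : N) = 0 := by simp [btmul]

theorem add_btmul (a a' : A) (n : N) : btmul B (a + a') n = btmul B a n + btmul B a' n := by
  simp [btmul, TensorProduct.add_tmul]

theorem btmul_smul_base (r : k) (a : A) (n : N) : btmul B a (r • n) = r • btmul B a n := by
  simp [btmul]

theorem smul_btmul (a a' : A) (n : N) : a • btmul B a' n = btmul B (a * a') n := by
  simp [btmul, ← Submodule.Quotient.mk_smul, TensorProduct.smul_tmul']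

theorem btmul_eq_smul (a : A) (n : N) : btmul B a n = a • btmul B 1 n := by
  rw [smul_btmul, mul_one]

theorem balLift_btmul {X : Type*} [AddCommGroup X] [Module k X] (f : A ⊗[k] N →ₗ[k] X)
    (hf : ∀ (a : A) (b : B) (n : N), f ((a * (b : A)) ⊗ₜ[k] n) = f (a ⊗ₜ[k] (b • n)))
    (a : A) (n : N) : balLift B f hf (btmul B a n) = f (a ⊗ₜ[k] n) := rfl

theorem balMap_btmul (f : N →ₗ[B] N') (a : A) (n : N) :
    balMap B f (btmul B a n) = btmul B a (f n) := rfl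

theorem balMap_smul (f : N →ₗ[B] N') (a : A) (x : BalTensor B N) :
    balMap B f (a • x) = a • balMap B f x := by
  induction x using btmul_induction with
  | btmul c n => simp only [smul_btmul, balMap_btmul]
  | zero => simp
  | add x y hx hy => simp only [smul_add, map_add, hx, hy]

end BalTensor

/-! ### The Galois isomorphism `A ⊗_B N ≃ N ⊗ H` for an `A`-module `N`. -/

section Galois

variable {k : Type v} {H A : Type u} [Field k] [Ring H] [HopfAlgebra k H]
  [Ring A] [Algebra k A] [RightComoduleAlgebra k H A]
  {N : Type u} [AddCommGroup N] [Module k N] [Module (coinvariants k H A) N]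
  [IsScalarTower k (coinvariants k H A) N]

/-- A representation `σ` of `A` on `N` extends the `B`-module structure of `N`. -/
def RestrictsTo (σ : A →ₐ[k] Module.End k N) : Prop :=
  ∀ (b : coinvariants k H A) (n : N), σ (b : A) n = b • n

/-- The diagonal action `(a ⊗ g, n ⊗ h) ↦ a n ⊗ g h`. -/
def diagAct (σ : A →ₐ[k] Module.End k N) (H : Type u) [Ring H] [Algebra k H] :
    A ⊗[k] H →ₗ[k] N ⊗[k] H →ₗ[k] N ⊗[k] H :=
  TensorProduct.map₂ σ.toLinearMap (LinearMap.mul k H)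

theorem diagAct_tmul (σ : A →ₐ[k] Module.End k N) (a : A) (g h : H) (n : N) :
    diagAct σ H (a ⊗ₜ[k] g) (n ⊗ₜ[k] h) = σ a n ⊗ₜ[k] (g * h) := rfl

theorem rTensor_flip_mul (σ : A →ₐ[k] Module.End k N) (x y : A ⊗[k] H) (n : N) :
    (σ.toLinearMap.flip n).rTensor H (x * y) =
      diagAct σ H x ((σ.toLinearMap.flip n).rTensor H y) := by
  induction x with
  | zero => simp
  | add x y hx hy => simp only [add_mul, map_add, LinearMap.add_apply, hx, hy]
  | tmul a h =>
    induction y with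
    | zero => simp
    | add x y hx hy => simp only [mul_add, map_add, hx, hy]
    | tmul b g => simp [diagAct_tmul]

/-- The map `a ⊗_B n ↦ a₍₀₎ n ⊗ a₍₁₎` from `A ⊗_B N` to `N ⊗ H` for a representation of `A`
on `N`. -/
def galoisMap (σ : A →ₐ[k] Module.End k N) (hσ : RestrictsTo (H := H) σ) :
    BalTensor (coinvariants k H A) N →ₗ[k] N ⊗[k] H :=
  balLift (coinvariants k H A)
    (TensorProduct.lift ((LinearMap.rTensorHom H ∘ₗ σ.toLinearMap.flip).flip ∘ₗ
      coact (k := k) (H := H)))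
    (by
      intro a b n
      have hb : coact (b : A) = (b : A) ⊗ₜ[k] (1 : H) := b.2
      simp only [TensorProduct.lift.tmul, LinearMap.comp_apply, LinearMap.flip_apply,
        LinearMap.coe_rTensorHom, RightComoduleAlgebra.coact_mul, hb]
      generalize (coact a : A ⊗[k] H) = x
      induction x with
      | zero => simp
      | add x y hx hy => simp only [add_mul, map_add, hx, hy]
      | tmul c h => simp [← hσ b n])

variable {σ : A →ₐ[k] Module.End k N} (hσ : RestrictsTo (H := H) σ)

theorem galoisMap_btmul (a : A) (n : N) :
    galoisMap σ hσ (btmul _ a n) = (σ.toLinearMap.flip n).rTensor H (coact a) := rfl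

theorem galoisMap_one_btmul (n : N) :
    galoisMap σ hσ (btmul _ 1 n) = n ⊗ₜ[k] (1 : H) := by
  rw [galoisMap_btmul, RightComoduleAlgebra.coact_one, Algebra.TensorProduct.one_def]
  simp

theorem galoisMap_smul (a : A) (x : BalTensor (coinvariants k H A) N) :
    galoisMap σ hσ (a • x) = diagAct σ H (coact a) (galoisMap σ hσ x) := by
  induction x using btmul_induction with
  | zero => simp
  | add x y hx hy => simp only [smul_add, map_add, hx, hy]
  | btmul c n =>
    rw [smul_btmul, galoisMap_btmul, galoisMap_btmul, RightComoduleAlgebra.coact_mul,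
      rTensor_flip_mul]

/-- `a ↦ a n`, as a `B`-linear map. -/
def orbitMap (n : N) : A →ₗ[coinvariants k H A] N where
  toFun a := σ a n
  map_add' a b := by simp
  map_smul' b a := by
    rw [RingHom.id_apply, ← hσ, Subalgebra.smul_def, smul_eq_mul, map_mul, Module.End.mul_apply]

theorem orbitMap_apply (n : N) (a : A) : orbitMap hσ n a = σ a n := rfl

theorem canonicalMap_btmul (a b : A) :
    canonicalMap k H A (btmul _ a b) = coact a * (b ⊗ₜ[k] (1 : H)) := by
  simp [canonicalMap, balLift_btmul]

/-- Compares the Galois map of `N` with the canonical map of `A` along the orbit map of `n`;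
properties of the latter pass to the former one `n` at a time. -/
theorem galoisMap_balMap_orbitMap (n : N) (x : BalTensor (coinvariants k H A) A) :
    galoisMap σ hσ (balMap _ (orbitMap hσ n) x) =
      (σ.toLinearMap.flip n).rTensor H (canonicalMap k H A x) := by
  induction x using btmul_induction with
  | zero => simp
  | add x y hx hy => simp only [map_add, hx, hy]
  | btmul a b =>
    rw [balMap_btmul, galoisMap_btmul, canonicalMap_btmul, orbitMap_apply]
    generalize (coact a : A ⊗[k] H) = x
    induction x with
    | zero => simp
    | add x y hx hy => simp only [add_mul, map_add, hx, hy]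
    | tmul c h => simp

theorem galoisMap_surjective (h : Function.Surjective (canonicalMap k H A)) :
    Function.Surjective (galoisMap σ hσ) := by
  intro y
  induction y with
  | zero => exact ⟨0, map_zero _⟩
  | add x y hx hy =>
    obtain ⟨x, rfl⟩ := hx
    obtain ⟨y, rfl⟩ := hy
    exact ⟨x + y, map_add _ _ _⟩
  | tmul n g =>
    obtain ⟨x, hx⟩ := h ((1 : A) ⊗ₜ[k] g)
    exact ⟨balMap _ (orbitMap hσ n) x, by rw [galoisMap_balMap_orbitMap, hx]; simp⟩

/-- Right multiplication by `c`, as a left `B`-linear map. -/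
def rightMul (B : Subalgebra k A) (c : A) : A →ₗ[B] A where
  toFun a := a * c
  map_add' a b := add_mul _ _ _
  map_smul' b a := by simp [Subalgebra.smul_def, mul_assoc]

/-- Right `A`-linearity of the canonical map; it reduces its inverse to the values on `1 ⊗ g`. -/
theorem canonicalMap_rightMul (c : A) (x : BalTensor (coinvariants k H A) A) :
    canonicalMap k H A (balMap _ (rightMul _ c) x) =
      canonicalMap k H A x * (c ⊗ₜ[k] (1 : H)) := by
  induction x using btmul_induction with
  | zero => simp
  | add x y hx hy => simp only [add_mul, map_add, hx, hy]
  | btmul a b =>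
    rw [balMap_btmul, canonicalMap_btmul, canonicalMap_btmul, mul_assoc]
    simp [rightMul]

theorem balMap_orbitMap_rightMul (n : N) (c : A) (x : BalTensor (coinvariants k H A) A) :
    balMap _ (orbitMap hσ n) (balMap _ (rightMul _ c) x) =
      balMap _ (orbitMap hσ (σ c n)) x := by
  induction x using btmul_induction with
  | zero => simp
  | add x y hx hy => simp only [map_add, hx, hy]
  | btmul a b => simp [balMap_btmul, orbitMap_apply, rightMul]

/-- A left inverse is `n ⊗ g ↦ (A ⊗_B orbit of n)(can⁻¹(1 ⊗ g))`. This replaces the identification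
of `N` with `A ⊗_A N`. -/
theorem galoisMap_injective (h : Function.Bijective (canonicalMap k H A)) :
    Function.Injective (galoisMap σ hσ) := by
  set e := LinearEquiv.ofBijective (canonicalMap k H A) h with he
  have hadd : ∀ (n n' : N) x, balMap _ (orbitMap hσ (n + n')) x =
      balMap _ (orbitMap hσ n) x + balMap _ (orbitMap hσ n') x := by
    intro n n' x
    induction x using btmul_induction with
    | zero => simp
    | add x y hx hy => rw [map_add, hx, hy, map_add, map_add]; abel
    | btmul a b => simp [balMap_btmul, orbitMap_apply, btmul_add]
  have hsmul : ∀ (r : k) (n : N) x, balMap _ (orbitMap hσ (r • n)) x =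
      r • balMap _ (orbitMap hσ n) x := by
    intro r n x
    induction x using btmul_induction with
    | zero => simp
    | add x y hx hy => rw [map_add, hx, hy, map_add, smul_add]
    | btmul a b => simp [balMap_btmul, orbitMap_apply, btmul_smul_base]
  let J : N ⊗[k] H →ₗ[k] BalTensor (coinvariants k H A) N := TensorProduct.lift
    (LinearMap.mk₂ k (fun n g => balMap _ (orbitMap hσ n) (e.symm ((1 : A) ⊗ₜ[k] g)))
      (fun n n' g => hadd n n' _) (fun r n g => hsmul r n _)
      (fun n g g' => by rw [TensorProduct.tmul_add, map_add, map_add])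
      (fun r n g => by rw [TensorProduct.tmul_smul, map_smul, map_smul]))
  -- Moving `c` from the argument of `can⁻¹` to the orbit map uses right `A`-linearity of `can`. The
  -- identity is then applied to `y = ρ(a)`, where `can⁻¹(ρ(a)) = a ⊗_B 1`.
  have hJ : ∀ (n : N) (y : A ⊗[k] H), J ((σ.toLinearMap.flip n).rTensor H y) =
      balMap _ (orbitMap hσ n) (e.symm y) := by
    intro n y
    induction y with
    | zero => simp
    | add x y hx hy => simp only [map_add, hx, hy]
    | tmul c g =>
      have h1 : e.symm (c ⊗ₜ[k] g) = balMap _ (rightMul _ c) (e.symm ((1 : A) ⊗ₜ[k] g)) := by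
        rw [LinearEquiv.symm_apply_eq]
        change _ = canonicalMap k H A _
        rw [canonicalMap_rightMul]
        change _ = e _ * _
        simp
      rw [h1, balMap_orbitMap_rightMul]
      rfl
  have hJg : Function.LeftInverse J (galoisMap σ hσ) := by
    intro x
    induction x using btmul_induction with
    | zero => simp
    | add x y hx hy => simp only [map_add, hx, hy]
    | btmul a n =>
      have h1 : e.symm (coact a) = btmul _ a (1 : A) := by
        rw [LinearEquiv.symm_apply_eq]
        change _ = canonicalMap k H A _
        rw [canonicalMap_btmul, ← Algebra.TensorProduct.one_def, mul_one]
      rw [galoisMap_btmul, hJ, h1, balMap_btmul, orbitMap_apply, map_one]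
      rfl
  exact hJg.injective

end Galois

/-! ### Faithfully flat descent: `M` is the module of coinvariants of `A ⊗_B M`. -/

section Descent

variable {k : Type v} {H A : Type u} [Field k] [Ring H] [HopfAlgebra k H]
  [Ring A] [Algebra k A] [RightComoduleAlgebra k H A]
  {M : Type u} [AddCommGroup M] [Module k M] [Module (coinvariants k H A) M]
  [IsScalarTower k (coinvariants k H A) M]

theorem inducedCoact_one_btmul (m : M) :
    inducedCoact k H A M (btmul _ 1 m) = btmul _ 1 m ⊗ₜ[k] (1 : H) := by
  rw [inducedCoact_btmul, RightComoduleAlgebra.coact_one, Algebra.TensorProduct.one_def]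
  rfl

theorem btmulLin_rTensor_mul (m : M) (x y : A ⊗[k] H) :
    (btmulLin k H A M m).rTensor H (x * y) =
      diagAct (Algebra.lsmul k k (BalTensor (coinvariants k H A) M)) H x
        ((btmulLin k H A M m).rTensor H y) := by
  induction x with
  | zero => simp
  | add x y hx hy => simp only [add_mul, map_add, LinearMap.add_apply, hx, hy]
  | tmul a g =>
    induction y with
    | zero => simp
    | add x y hx hy => simp only [mul_add, map_add, hx, hy]
    | tmul b h =>
      rw [Algebra.TensorProduct.tmul_mul_tmul, LinearMap.rTensor_tmul, LinearMap.rTensor_tmul,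
        diagAct_tmul]
      congr 1

theorem inducedCoact_smul (a : A) (p : BalTensor (coinvariants k H A) M) :
    inducedCoact k H A M (a • p) =
      diagAct (Algebra.lsmul k k (BalTensor (coinvariants k H A) M)) H (coact a)
        (inducedCoact k H A M p) := by
  induction p using btmul_induction with
  | zero => simp
  | add x y hx hy => simp only [smul_add, map_add, hx, hy]
  | btmul c m =>
    rw [smul_btmul, inducedCoact_btmul, inducedCoact_btmul, RightComoduleAlgebra.coact_mul,
      btmulLin_rTensor_mul]

theorem lsmul_restrictsTo : RestrictsTo (H := H)
    (Algebra.lsmul k k (BalTensor (coinvariants k H A) M) : A →ₐ[k] _) := fun _ _ => rfl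

variable (k H A M) in
/-- The `B`-submodule of coinvariants of `A ⊗_B M`. -/
def balCoinvariants : Submodule (coinvariants k H A) (BalTensor (coinvariants k H A) M) where
  carrier := {p | inducedCoact k H A M p = p ⊗ₜ[k] (1 : H)}
  add_mem' {p q} hp hq := by
    simp only [Set.mem_ofPred_eq] at hp hq ⊢
    rw [map_add, hp, hq, TensorProduct.add_tmul]
  zero_mem' := by
    simp only [Set.mem_ofPred_eq]
    rw [map_zero, TensorProduct.zero_tmul]
  smul_mem' b p hp := by
    simp only [Set.mem_ofPred_eq] at hp ⊢
    have hb : coact (b : A) = (b : A) ⊗ₜ[k] (1 : H) := b.2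
    change inducedCoact k H A M ((b : A) • p) = ((b : A) • p) ⊗ₜ[k] (1 : H)
    rw [inducedCoact_smul, hp, hb, diagAct_tmul, one_mul]
    rfl

theorem mem_balCoinvariants {p : BalTensor (coinvariants k H A) M} :
    p ∈ balCoinvariants k H A M ↔ inducedCoact k H A M p = p ⊗ₜ[k] (1 : H) := Iff.rfl

variable (k H A M) in
/-- The unit `m ↦ 1 ⊗_B m` of the adjunction between `B`-modules and relative Hopf modules. -/
def toBalCoinvariants : M →ₗ[coinvariants k H A] balCoinvariants k H A M where
  toFun m := ⟨btmul _ 1 m, inducedCoact_one_btmul m⟩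
  map_add' m m' := Subtype.ext (btmul_add _ _ _)
  map_smul' b m := Subtype.ext (by
    change btmul (coinvariants k H A) 1 (b • m) = (b : A) • btmul _ 1 m
    rw [smul_btmul, ← btmul_mul_coe, mul_one, one_mul])

/-- Let `K` be the kernel. By flatness `A ⊗_B K` embeds in `A ⊗_B M`, but the embedding sends `a ⊗
n` to `a(1 ⊗ n) = 0`. Hence `A ⊗_B K = 0`, and faithfulness gives `K = 0`. -/
theorem one_btmul_injective (hA : RightFaithfullyFlat (coinvariants k H A)) :
    Function.Injective (fun m : M => btmul (coinvariants k H A) (1 : A) m) := by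
  have hker : Subsingleton (LinearMap.ker (toBalCoinvariants k H A M)) := by
    apply hA.faithful
    refine subsingleton_of_forall_eq 0 fun x => ?_
    apply hA.flat _ _ (LinearMap.ker (toBalCoinvariants k H A M)).subtype
      Subtype.val_injective
    rw [map_zero]
    induction x using btmul_induction with
    | zero => exact map_zero _
    | add x y hx hy => rw [map_add, hx, hy, add_zero]
    | btmul a n =>
      have hn : btmul (coinvariants k H A) (1 : A) (n : M) = 0 := congrArg Subtype.val n.2
      rw [balMap_btmul, btmul_eq_smul, Submodule.subtype_apply, hn, smul_zero]
  intro m m' h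
  have hm : m - m' ∈ LinearMap.ker (toBalCoinvariants k H A M) := by
    rw [LinearMap.mem_ker, map_sub, sub_eq_zero]
    exact Subtype.ext h
  exact sub_eq_zero.1 (congrArg Subtype.val
    (hker.elim (⟨_, hm⟩ : LinearMap.ker (toBalCoinvariants k H A M)) 0))

/-- Here the Galois map is that of the `A`-module `P = A ⊗_B M` itself: `a ⊗ m` goes to `a₍₀₎(1 ⊗ m)
⊗ a₍₁₎`, which is the coaction. -/
theorem galoisMap_balMap_subtype_toBalCoinvariants (y : BalTensor (coinvariants k H A) M) :
    galoisMap (Algebra.lsmul k k (BalTensor (coinvariants k H A) M)) lsmul_restrictsTo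
      (balMap _ (balCoinvariants k H A M).subtype (balMap _ (toBalCoinvariants k H A M) y)) =
      inducedCoact k H A M y := by
  induction y using btmul_induction with
  | zero => simp
  | add x y hx hy => simp only [map_add, hx, hy]
  | btmul a m =>
    rw [balMap_btmul, balMap_btmul, galoisMap_btmul, inducedCoact_btmul]
    congr 1
    refine congrArg _ (LinearMap.ext fun c => ?_)
    exact (btmul_eq_smul c m).symm

theorem balMap_toBalCoinvariants_surjective (hA : IsFaithfullyFlatGalois k H A) :
    Function.Surjective (balMap _ (toBalCoinvariants k H A M)) := by
  intro x
  induction x using btmul_induction with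
  | zero => exact ⟨0, map_zero _⟩
  | add x y hx hy =>
    obtain ⟨x, rfl⟩ := hx
    obtain ⟨y, rfl⟩ := hy
    exact ⟨x + y, map_add _ _ _⟩
  | btmul a n =>
    -- Flatness and the Galois property embed `A ⊗_B P^{co H}` into `P ⊗ H`. There `a ⊗ n` becomes
    -- `a₍₀₎n ⊗ a₍₁₎ = ρ(an)`, since `n` is coinvariant, and the previous lemma recognises `ρ(an)`
    -- as the image of `an`.
    refine ⟨a • (n : BalTensor (coinvariants k H A) M), ?_⟩
    apply hA.faithfullyFlat.flat _ _ (balCoinvariants k H A M).subtype Subtype.val_injective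
    apply galoisMap_injective lsmul_restrictsTo hA.galois
    rw [galoisMap_balMap_subtype_toBalCoinvariants, balMap_btmul, galoisMap_btmul,
      inducedCoact_smul, mem_balCoinvariants.1 n.2]
    generalize (coact a : A ⊗[k] H) = x
    induction x with
    | zero => simp
    | add x y hx hy => simp only [map_add, LinearMap.add_apply, hx, hy]
    | tmul c h => rw [diagAct_tmul, mul_one]; rfl

/-- Every coinvariant of `A ⊗_B M` has the form `1 ⊗_B m`. -/
theorem exists_one_btmul_eq (hA : IsFaithfullyFlatGalois k H A)
    {p : BalTensor (coinvariants k H A) M}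
    (hp : inducedCoact k H A M p = p ⊗ₜ[k] (1 : H)) :
    ∃ m : M, btmul _ 1 m = p := by
  set R := LinearMap.range (toBalCoinvariants k H A M) with hR
  -- The cokernel vanishes after `A ⊗_B -`: each `a ⊗ q` lifts to `A ⊗_B P^{co H}`, hence comes from
  -- `A ⊗_B M`, which dies in the quotient.
  have hQ : Subsingleton (balCoinvariants k H A M ⧸ R) := by
    apply hA.faithfullyFlat.faithful
    refine subsingleton_of_forall_eq 0 fun x => ?_
    induction x using btmul_induction with
    | zero => rfl
    | add x y hx hy => rw [hx, hy, add_zero]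
    | btmul a q =>
      obtain ⟨n, rfl⟩ := Submodule.mkQ_surjective R q
      rw [← balMap_btmul]
      obtain ⟨y, hy⟩ := balMap_toBalCoinvariants_surjective hA (btmul _ a n)
      rw [← hy]
      clear hy
      induction y using btmul_induction with
      | zero => simp
      | add x y hx hy => rw [map_add, map_add, hx, hy, add_zero]
      | btmul c m =>
        have : R.mkQ (toBalCoinvariants k H A M m) = 0 := by
          rw [Submodule.mkQ_apply, Submodule.Quotient.mk_eq_zero]
          exact ⟨m, rfl⟩
        rw [balMap_btmul, balMap_btmul, this, btmul_zero]
  have h1 : (⟨p, hp⟩ : balCoinvariants k H A M) ∈ R := by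
    rw [← Submodule.Quotient.mk_eq_zero]
    exact Subsingleton.elim _ _
  obtain ⟨m, hm⟩ := h1
  exact ⟨m, congrArg Subtype.val hm⟩

end Descent

/-! ### From an `A`-module structure to an element of `Ω_E`. -/

section Translation

variable {k : Type v} {H A : Type u} [Field k] [Ring H] [HopfAlgebra k H]
  [Ring A] [Algebra k A] [RightComoduleAlgebra k H A]
  {M : Type u} [AddCommGroup M] [Module k M] [Module (coinvariants k H A) M]
  [IsScalarTower k (coinvariants k H A) M]
  {σ : A →ₐ[k] Module.End k M} (hσ : RestrictsTo (H := H) σ)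
  (hg : Function.Bijective (canonicalMap k H A))

/-- `A ⊗_B M ≃ M ⊗ H` for an `A`-module `M`. -/
def galoisEquiv : BalTensor (coinvariants k H A) M ≃ₗ[k] M ⊗[k] H :=
  LinearEquiv.ofBijective (galoisMap σ hσ)
    ⟨galoisMap_injective hσ hg, galoisMap_surjective hσ hg.surjective⟩

theorem galoisEquiv_apply (p : BalTensor (coinvariants k H A) M) :
    galoisEquiv hσ hg p = galoisMap σ hσ p := rfl

/-- The diagonal action multiplies `H` from the left, so it commutes with right multiplication; this
is the `A`-linearity of translations. -/
theorem lTensor_mulRight_diagAct (h : H) (x : A ⊗[k] H) (y : M ⊗[k] H) :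
    (LinearMap.mulRight k h).lTensor M (diagAct σ H x y) =
      diagAct σ H x ((LinearMap.mulRight k h).lTensor M y) := by
  induction x with
  | zero => simp
  | add x y hx hy => simp only [map_add, LinearMap.add_apply, hx, hy]
  | tmul a g =>
    induction y with
    | zero => simp
    | add x y hx hy => simp only [map_add, hx, hy]
    | tmul b g' => simp [diagAct_tmul, mul_assoc]

/-- The `A`-endomorphism of `A ⊗_B M ≃ M ⊗ H` given by right multiplication by `h` on `H`. -/
def translation (h : H) : Module.End A (BalTensor (coinvariants k H A) M) where
  toFun p := (galoisEquiv hσ hg).symm ((LinearMap.mulRight k h).lTensor M (galoisEquiv hσ hg p))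
  map_add' p q := by simp only [map_add]
  map_smul' a p := by
    rw [RingHom.id_apply, LinearEquiv.symm_apply_eq, galoisEquiv_apply, galoisEquiv_apply,
      galoisMap_smul, galoisMap_smul, ← galoisEquiv_apply hσ hg (LinearEquiv.symm _ _),
      LinearEquiv.apply_symm_apply, lTensor_mulRight_diagAct]
    rfl

theorem galoisMap_translation (h : H) (p : BalTensor (coinvariants k H A) M) :
    galoisMap σ hσ (translation hσ hg h p) =
      (LinearMap.mulRight k h).lTensor M (galoisMap σ hσ p) :=
  (galoisEquiv hσ hg).apply_symm_apply _

/-- `h ↦ translation h`, linearly. -/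
def translationLin : H →ₗ[k] (Module.End A (BalTensor (coinvariants k H A) M))ᵐᵒᵖ where
  toFun h := op (translation hσ hg h)
  map_add' h h' := unop_injective (LinearMap.ext fun p => galoisMap_injective hσ hg (by
    simp only [unop_add, unop_op, LinearMap.add_apply, map_add, galoisMap_translation]
    generalize galoisMap σ hσ p = y
    induction y with
    | zero => simp
    | add x y hx hy => simp only [map_add, hx, hy]; abel
    | tmul m g => simp [mul_add, TensorProduct.tmul_add]))
  map_smul' r h := unop_injective (LinearMap.ext fun p => galoisMap_injective hσ hg (by
    simp only [unop_smul, unop_op, LinearMap.smul_apply, map_smul, galoisMap_translation,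
      RingHom.id_apply]
    generalize galoisMap σ hσ p = y
    induction y with
    | zero => simp
    | add x y hx hy => simp only [map_add, smul_add, hx, hy]
    | tmul m g => simp))

theorem translationLin_apply (h : H) :
    translationLin hσ hg h = op (translation hσ hg h) := rfl

/-- The isomorphism `A ⊗_B M ≃ M ⊗ H` is colinear. -/
theorem galoisMap_rTensor_inducedCoact (p : BalTensor (coinvariants k H A) M) :
    TensorProduct.assoc k M H H ((galoisMap σ hσ).rTensor H (inducedCoact k H A M p)) =
      (comul (R := k) (A := H)).lTensor M (galoisMap σ hσ p) := by
  induction p using btmul_induction with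
  | zero => simp
  | add x y hx hy => simp only [map_add, hx, hy]
  | btmul a m =>
    have h1 : galoisMap σ hσ ∘ₗ btmulLin k H A M m =
      (σ.toLinearMap.flip m).rTensor H ∘ₗ coact (k := k) (H := H) := rfl
    have h2 : ∀ y : (A ⊗[k] H) ⊗[k] H, TensorProduct.assoc k _ H H
        (((σ.toLinearMap.flip m).rTensor H).rTensor H y) =
        (σ.toLinearMap.flip m).rTensor (H ⊗[k] H) (TensorProduct.assoc k A H H y) := by
      intro y
      induction y with
      | zero => simp
      | add x y hx hy => simp only [map_add, hx, hy]
      | tmul x h =>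
        induction x with
        | zero => simp
        | add x y hx hy => simp only [map_add, TensorProduct.add_tmul, hx, hy]
        | tmul a h => simp
    rw [inducedCoact_btmul, ← LinearMap.comp_apply (LinearMap.rTensor _ _) (LinearMap.rTensor _ _),
      ← LinearMap.rTensor_comp, h1, LinearMap.rTensor_comp, LinearMap.comp_apply, h2,
      coassoc_apply, ← LinearMap.comp_apply, LinearMap.rTensor_comp_lTensor,
      ← LinearMap.lTensor_comp_rTensor, LinearMap.comp_apply, galoisMap_btmul]

/-- Read in `M ⊗ H ⊗ H`, acting by translations along the tensor `z` is right multiplication by `z`.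
-/
theorem galoisMap_rTensor_tensorAct (z : H ⊗[k] H)
    (x : BalTensor (coinvariants k H A) M ⊗[k] H) :
    TensorProduct.assoc k M H H ((galoisMap σ hσ).rTensor H
      (tensorAct A _ H ((translationLin hσ hg).rTensor H z) x)) =
    (LinearMap.mulRight k z).lTensor M
      (TensorProduct.assoc k M H H ((galoisMap σ hσ).rTensor H x)) := by
  have hadd : ∀ (z w : H ⊗[k] H) (y : M ⊗[k] (H ⊗[k] H)),
      (LinearMap.mulRight k (z + w)).lTensor M y =
      (LinearMap.mulRight k z).lTensor M y + (LinearMap.mulRight k w).lTensor M y := by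
    intro z w y
    induction y with
    | zero => simp
    | add x y hx hy => simp only [map_add, hx, hy]; abel
    | tmul m g => simp [mul_add, TensorProduct.tmul_add]
  induction z with
  | zero =>
    have : LinearMap.mulRight k (0 : H ⊗[k] H) = 0 := by ext; simp
    rw [this]
    simp
  | add z w hz hw => rw [hadd, ← hz, ← hw]; simp only [map_add, LinearMap.add_apply]
  | tmul h h' =>
    induction x with
    | zero => simp
    | add x y hx hy => simp only [map_add, hx, hy]
    | tmul p g =>
      rw [LinearMap.rTensor_tmul, translationLin_apply, tensorAct_tmul, unop_op,
        LinearMap.rTensor_tmul, LinearMap.rTensor_tmul, galoisMap_translation]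
      generalize galoisMap σ hσ p = y
      induction y with
      | zero => simp
      | add x y hx hy => simp only [map_add, TensorProduct.add_tmul, hx, hy]
      | tmul m g' => simp

/-- Colinearity of the Galois map moves the claim to `M ⊗ H ⊗ H`, where it is `Δ(gh) = Δ(g)Δ(h)`.
The same witness gives both membership in `E` and colinearity of `h ↦ translation h`. -/
theorem translation_isRational (h : H) :
    IsRationalWith (translationLin hσ hg h) ((translationLin hσ hg).rTensor H (comul h)) := by
  intro p
  have hinj : Function.Injective ((galoisMap σ hσ).rTensor H) :=
    Module.Flat.rTensor_preserves_injective_linearMap _ (galoisMap_injective hσ hg)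
  apply hinj
  apply (TensorProduct.assoc k M H H).injective
  change TensorProduct.assoc k M H H ((galoisMap σ hσ).rTensor H
    (inducedCoact k H A M (translation hσ hg h p))) = TensorProduct.assoc k M H H
      ((galoisMap σ hσ).rTensor H (tensorAct A _ H _ (inducedCoact k H A M p)))
  rw [galoisMap_rTensor_tensorAct, galoisMap_rTensor_inducedCoact, galoisMap_rTensor_inducedCoact,
    galoisMap_translation]
  generalize galoisMap σ hσ p = y
  induction y with
  | zero => simp
  | add x y hx hy => simp only [map_add, hx, hy]
  | tmul m g => simp

/-- The algebra map `H → E` defined by the translations. -/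
def translationAlgHom : H →ₐ[k] LiftAlgebra k H A M :=
  AlgHom.ofLinearMap
    ((translationLin hσ hg).codRestrict (Subalgebra.toSubmodule (LiftAlgebra k H A M))
      fun h => ⟨_, translation_isRational hσ hg h⟩)
    (Subtype.ext (unop_injective (LinearMap.ext fun p => galoisMap_injective hσ hg (by
      change galoisMap σ hσ (translation hσ hg 1 p) = galoisMap σ hσ p
      rw [galoisMap_translation, LinearMap.mulRight_one, LinearMap.lTensor_id]
      rfl))))
    (fun g h => Subtype.ext (unop_injective (LinearMap.ext fun p => galoisMap_injective hσ hg (by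
      change galoisMap σ hσ (translation hσ hg (g * h) p) =
        galoisMap σ hσ (translation hσ hg h (translation hσ hg g p))
      rw [galoisMap_translation, galoisMap_translation, galoisMap_translation,
        LinearMap.mulRight_mul, LinearMap.lTensor_comp]
      rfl))))

theorem translationAlgHom_apply (h : H) (p : BalTensor (coinvariants k H A) M) :
    (translationAlgHom hσ hg h).1.unop p = translation hσ hg h p := rfl

variable [HasBijectiveAntipode k H]

/-- The element of `Ω_E` defined by the translations. -/
def translationOmega : Omega k H (LiftAlgebra k H A M) :=
  ⟨translationAlgHom hσ hg, fun h => rationalCoact_eq (by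
    have := translation_isRational hσ hg h
    rw [← LinearMap.comp_apply, ← LinearMap.rTensor_comp]
    exact this)⟩

end Translation

/-! ### The formula linking actions and algebra maps, and its uniqueness properties. -/

section Correspondence

variable {k : Type v} {H A : Type u} [Field k] [Ring H] [HopfAlgebra k H]
  [Ring A] [Algebra k A] [RightComoduleAlgebra k H A]
  {M : Type u} [AddCommGroup M] [Module k M] [Module (coinvariants k H A) M]
  [IsScalarTower k (coinvariants k H A) M]

theorem liftAlgebra_mul_apply (f g : LiftAlgebra k H A M)
    (p : BalTensor (coinvariants k H A) M) : (f * g).1.unop p = g.1.unop (f.1.unop p) := rfl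

theorem liftAlgebra_one_apply (p : BalTensor (coinvariants k H A) M) :
    (1 : LiftAlgebra k H A M).1.unop p = p := rfl

/-- `c ⊗ h ↦ t(S(h))(c ⊗_B m)`. -/
def antipodeEvalMap (t : H →ₗ[k] LiftAlgebra k H A M) (m : M) :
    A ⊗[k] H →ₗ[k] BalTensor (coinvariants k H A) M :=
  TensorProduct.lift
    ((LinearMap.restrictScalarsₗ k A _ _ k ∘ₗ (opLinearEquiv k).symm.toLinearMap ∘ₗ
      (LiftAlgebra k H A M).val.toLinearMap ∘ₗ t ∘ₗ antipode k).flip ∘ₗ btmulLin k H A M m)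

theorem antipodeEval_eq (t : H →ₗ[k] LiftAlgebra k H A M) (a : A) (m : M) :
    antipodeEval t a m = antipodeEvalMap t m (coact a) := rfl

theorem antipodeEvalMap_tmul (t : H →ₗ[k] LiftAlgebra k H A M) (m : M) (c : A) (h : H) :
    antipodeEvalMap t m (c ⊗ₜ[k] h) = (t (antipode k h)).1.unop (btmul _ c m) := rfl

theorem antipodeEvalMap_add (t : H →ₗ[k] LiftAlgebra k H A M) (m m' : M) (x : A ⊗[k] H) :
    antipodeEvalMap t (m + m') x = antipodeEvalMap t m x + antipodeEvalMap t m' x := by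
  induction x with
  | zero => simp
  | add x y hx hy => rw [map_add, map_add, map_add, hx, hy]; abel
  | tmul c h => simp only [antipodeEvalMap_tmul, btmul_add, map_add]

theorem antipodeEvalMap_zero (t : H →ₗ[k] LiftAlgebra k H A M) (x : A ⊗[k] H) :
    antipodeEvalMap t (0 : M) x = 0 := by
  induction x with
  | zero => simp
  | add x y hx hy => rw [map_add, hx, hy, add_zero]
  | tmul c h => simp only [antipodeEvalMap_tmul, btmul_zero, map_zero]

/-- Two reversals cancel: `S` is antimultiplicative and the product of `E` is opposite to
composition. This is the source of `(ab)m = a(bm)`. -/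
theorem antipodeEvalMap_mul (t : H →ₐ[k] LiftAlgebra k H A M) (m : M) (c : A) (g : H)
    (y : A ⊗[k] H) : antipodeEvalMap t.toLinearMap m ((c ⊗ₜ[k] g) * y) =
      (t (antipode k g)).1.unop (c • antipodeEvalMap t.toLinearMap m y) := by
  induction y with
  | zero => simp
  | add x y hx hy => rw [mul_add, map_add, hx, hy, map_add, smul_add, map_add]
  | tmul d h =>
    rw [Algebra.TensorProduct.tmul_mul_tmul, antipodeEvalMap_tmul, antipodeEvalMap_tmul,
      antipode_mul_antidistrib, AlgHom.toLinearMap_apply, map_mul, liftAlgebra_mul_apply,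
      AlgHom.toLinearMap_apply, ← map_smul, smul_btmul]

/-- Coassociativity in usable form: both sides equal `V(a₍₀₎ ⊗ a₍₁₎ ⊗ a₍₂₎)`, the first by splitting
`a₍₀₎` and the second by splitting `a₍₁₎`. -/
theorem rTensor_coact_induction {X : Type*} [AddCommGroup X] [Module k X]
    (F : A ⊗[k] H →ₗ[k] X) (V : A ⊗[k] (H ⊗[k] H) →ₗ[k] X) (G : A ⊗[k] H →ₗ[k] X)
    (h₁ : ∀ (c : A) (h : H), F (c ⊗ₜ[k] h) =
      V (TensorProduct.assoc k A H H (coact c ⊗ₜ[k] h)))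
    (h₂ : ∀ (c : A) (h : H), V (c ⊗ₜ[k] comul h) = G (c ⊗ₜ[k] h)) (a : A) :
    F (coact a) = G (coact a) := by
  have e₁ : F = V ∘ₗ (TensorProduct.assoc k A H H).toLinearMap ∘ₗ
      (coact (k := k) (H := H)).rTensor H := by
    ext c h
    simpa using h₁ c h
  have e₂ : G = V ∘ₗ (comul (R := k) (A := H)).lTensor A := by
    ext c h
    simpa using (h₂ c h).symm
  rw [e₁, e₂]
  exact congrArg V (coassoc_apply a)

theorem tensorAct_tmul_one (f : (Module.End A (BalTensor (coinvariants k H A) M))ᵐᵒᵖ)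
    (x : BalTensor (coinvariants k H A) M ⊗[k] H) :
    tensorAct A _ H (f ⊗ₜ[k] (1 : H)) x = (f.unop.restrictScalars k).rTensor H x := by
  induction x with
  | zero => simp
  | add x y hx hy => simp only [map_add, hx, hy]
  | tmul p h => rw [tensorAct_tmul, mul_one]; rfl

/-- The action `σ` of `A` on `M` is given by `1 ⊗_B a m = t(S(a₍₁₎))(a₍₀₎ ⊗_B m)`. -/
def Corresponds (σ : A →ₐ[k] Module.End k M) (t : H →ₗ[k] LiftAlgebra k H A M) : Prop :=
  ∀ (a : A) (m : M), btmul (coinvariants k H A) 1 (σ a m) = antipodeEval t a m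

/-- `m ⊗ h ↦ t(h)(1 ⊗_B m)`. -/
def evalOne (t : H →ₗ[k] LiftAlgebra k H A M) :
    M ⊗[k] H →ₗ[k] BalTensor (coinvariants k H A) M :=
  TensorProduct.lift (((LinearMap.restrictScalarsₗ k A _ _ k ∘ₗ
    (opLinearEquiv k).symm.toLinearMap ∘ₗ (LiftAlgebra k H A M).val.toLinearMap ∘ₗ t).flip) ∘ₗ
      (btmulLin k H A M).flip 1)

theorem evalOne_tmul (t : H →ₗ[k] LiftAlgebra k H A M) (m : M) (h : H) :
    evalOne t (m ⊗ₜ[k] h) = (t h).1.unop (btmul _ 1 m) := rfl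

/-- Since the product of `E` is opposite, `t(gh)` applies `t(g)` first and then `t(h)`. -/
theorem evalOne_lTensor_mulRight (t : H →ₐ[k] LiftAlgebra k H A M) (h : H) (y : M ⊗[k] H) :
    evalOne t.toLinearMap ((LinearMap.mulRight k h).lTensor M y) =
      (t h).1.unop (evalOne t.toLinearMap y) := by
  induction y with
  | zero => simp
  | add x y hx hy => simp only [map_add, hx, hy]
  | tmul m g =>
    rw [LinearMap.lTensor_tmul, LinearMap.mulRight_apply, evalOne_tmul, AlgHom.toLinearMap_apply,
      map_mul, liftAlgebra_mul_apply]
    rfl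

variable {σ : A →ₐ[k] Module.End k M} (hσ : RestrictsTo (H := H) σ)

theorem translation_corresponds (hg : Function.Bijective (canonicalMap k H A)) :
    Corresponds σ (translationAlgHom hσ hg).toLinearMap := by
  intro a m
  apply galoisMap_injective hσ hg
  rw [galoisMap_one_btmul, antipodeEval_eq, ← LinearMap.comp_apply (galoisMap σ hσ)]
  -- The middle map is `c ⊗ g ⊗ h ↦ cm ⊗ g S(h)`; the antipode axiom collapses `a₍₀₎m ⊗ a₍₁₎S(a₍₂₎)`
  -- to `am ⊗ 1`.
  rw [rTensor_coact_induction (galoisMap σ hσ ∘ₗ antipodeEvalMap _ m)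
    (TensorProduct.map (σ.toLinearMap.flip m)
      (LinearMap.mul' k H ∘ₗ (antipode k : H →ₗ[k] H).lTensor H))
    (TensorProduct.map (σ.toLinearMap.flip m) (Algebra.linearMap k H ∘ₗ counit)) ?_ ?_]
  · conv_lhs => rw [← slice_counit_coact (k := k) (H := H) a]
    generalize (coact a : A ⊗[k] H) = x
    induction x with
    | zero => simp
    | add x y hx hy => simp only [map_add, LinearMap.add_apply, TensorProduct.add_tmul, hx, hy]
    | tmul c h =>
      simp [slice_tmul, Algebra.algebraMap_eq_smul_one, TensorProduct.smul_tmul]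
  · intro c h
    rw [LinearMap.comp_apply, antipodeEvalMap_tmul, AlgHom.toLinearMap_apply,
      translationAlgHom_apply, galoisMap_translation, galoisMap_btmul]
    generalize (coact c : A ⊗[k] H) = x
    induction x with
    | zero => simp
    | add x y hx hy => simp only [map_add, TensorProduct.add_tmul, hx, hy]
    | tmul d g => simp
  · intro c h
    rw [TensorProduct.map_tmul, TensorProduct.map_tmul, LinearMap.comp_apply,
      mul_antipode_lTensor_comul_apply]
    rfl

variable {t : H →ₐ[k] LiftAlgebra k H A M}

/-- By the formula for `t`, `t(a₍₁₎)(1 ⊗ a₍₀₎m) = t(S(a₍₁₎)a₍₂₎)(a₍₀₎ ⊗ m) = a ⊗ m`. So `evalOne t`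
is a left inverse of the Galois map, whichever corresponding `t` is taken. -/
theorem evalOne_galoisMap (ht : Corresponds σ t.toLinearMap)
    (p : BalTensor (coinvariants k H A) M) :
    evalOne t.toLinearMap (galoisMap σ hσ p) = p := by
  induction p using btmul_induction with
  | zero => simp
  | add x y hx hy => simp only [map_add, hx, hy]
  | btmul a m =>
    rw [galoisMap_btmul, ← LinearMap.comp_apply (evalOne _)]
    let T : H →ₗ[k] BalTensor (coinvariants k H A) M →ₗ[k] BalTensor (coinvariants k H A) M :=
      LinearMap.restrictScalarsₗ k A _ _ k ∘ₗ (opLinearEquiv k).symm.toLinearMap ∘ₗ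
        (LiftAlgebra k H A M).val.toLinearMap ∘ₗ t.toLinearMap
    rw [rTensor_coact_induction (evalOne _ ∘ₗ (σ.toLinearMap.flip m).rTensor H)
      (TensorProduct.lift (LinearMap.compl₁₂ T.flip (btmulLin k H A M m)
        (LinearMap.mul' k H ∘ₗ (antipode k : H →ₗ[k] H).rTensor H)))
      (btmulLin k H A M m ∘ₗ slice A counit) ?_ ?_]
    · rw [LinearMap.comp_apply, slice_counit_coact]
      rfl
    · intro c h
      have h1 : (evalOne t.toLinearMap ∘ₗ (σ.toLinearMap.flip m).rTensor H) (c ⊗ₜ[k] h) =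
          T h (antipodeEvalMap t.toLinearMap m (coact c)) := by
        rw [← antipodeEval_eq, ← ht]
        rfl
      rw [h1]
      generalize (coact c : A ⊗[k] H) = x
      induction x with
      | zero => simp
      | add x y hx hy => simp only [map_add, TensorProduct.add_tmul, hx, hy]
      | tmul d g =>
        change (t h).1.unop ((t (antipode k g)).1.unop (btmul _ d m)) =
          (t (antipode k g * h)).1.unop (btmul _ d m)
        rw [map_mul, liftAlgebra_mul_apply]
    · intro c h
      rw [TensorProduct.lift.tmul, LinearMap.compl₁₂_apply, LinearMap.comp_apply,
        mul_antipode_rTensor_comul_apply, LinearMap.comp_apply, slice_tmul, map_smul,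
        Algebra.algebraMap_eq_smul_one, map_smul]
      congr 1
      change (t 1).1.unop (btmul _ c m) = _
      rw [map_one, liftAlgebra_one_apply]
      rfl

/-- Surjectivity of the Galois map makes its left inverse `evalOne` independent of `t`. Under it
`t(h)` is right multiplication by `h`, so `t` is determined too. -/
theorem Corresponds.algHom_unique (hg : Function.Bijective (canonicalMap k H A))
    (hσ : RestrictsTo (H := H) σ) {t' : H →ₐ[k] LiftAlgebra k H A M}
    (ht : Corresponds σ t.toLinearMap) (ht' : Corresponds σ t'.toLinearMap) : t = t' := by
  have h1 : evalOne t.toLinearMap = evalOne t'.toLinearMap := by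
    refine LinearMap.ext fun y => ?_
    obtain ⟨p, rfl⟩ := galoisMap_surjective hσ hg.surjective y
    rw [evalOne_galoisMap hσ ht, evalOne_galoisMap hσ ht']
  refine AlgHom.ext fun h => Subtype.ext (unop_injective (LinearMap.ext fun p => ?_))
  rw [← evalOne_galoisMap hσ ht p, ← evalOne_lTensor_mulRight, h1, evalOne_lTensor_mulRight]

theorem Corresponds.rep_unique (hA : IsFaithfullyFlatGalois k H A)
    {σ' : A →ₐ[k] Module.End k M} {t : H →ₗ[k] LiftAlgebra k H A M}
    (ht : Corresponds σ t) (ht' : Corresponds σ' t) : σ = σ' :=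
  AlgHom.ext fun a => LinearMap.ext fun m =>
    one_btmul_injective hA.faithfullyFlat ((ht a m).trans (ht' a m).symm)

end Correspondence

/-! ### From `Ω_E` back to module structures, and the two equivalence relations. -/

section Extensions

variable {k : Type v} {H A : Type u} [Field k] [Ring H] [HopfAlgebra k H]
  [Ring A] [Algebra k A] [RightComoduleAlgebra k H A]
  {M : Type u} [AddCommGroup M] [Module k M] [Module (coinvariants k H A) M]
  [IsScalarTower k (coinvariants k H A) M]

/-- The representation of `A` on `M` given by an extension of the `B`-module structure. -/
def ModuleExtension.rep (s : ModuleExtension k H A M) : A →ₐ[k] Module.End k M :=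
  letI := s.toModule
  -- Scalars of `k` lie in `B`, where the action is prescribed, so any extension is automatically
  -- `k`-linear.
  have hk : ∀ (r : k) (m : M), algebraMap k A r • m = r • m := fun r m => by
    rw [← algebraMap_smul (coinvariants k H A) r m]
    exact s.extendsAction (algebraMap k (coinvariants k H A) r) m
  haveI : IsScalarTower k A M :=
    ⟨fun r a m => by rw [Algebra.smul_def, mul_smul, hk]⟩
  Algebra.lsmul k k M

theorem ModuleExtension.rep_restrictsTo (s : ModuleExtension k H A M) :
    RestrictsTo (H := H) s.rep := s.extendsAction

theorem ModuleExtension.rep_injective :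
    Function.Injective (ModuleExtension.rep : ModuleExtension k H A M → _) := by
  rintro ⟨m₁, h₁⟩ ⟨m₂, h₂⟩ h
  have : m₁ = m₂ := by
    apply Module.ext
    funext a m
    exact LinearMap.congr_fun (AlgHom.congr_fun h a) m
  subst this
  rfl

variable [HasBijectiveAntipode k H]

/-- Colinearity of a map `H → E`. -/
def IsColinear (t : H →ₐ[k] LiftAlgebra k H A M) : Prop :=
  ∀ h : H, rationalCoact (t h) = t.toLinearMap.rTensor H (comul (R := k) h)

/-- The underlying map of an element of `Ω_E`. -/
def omegaHom (t : Omega k H (LiftAlgebra k H A M)) : H →ₐ[k] LiftAlgebra k H A M := t.1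

theorem omegaHom_isColinear (t : Omega k H (LiftAlgebra k H A M)) :
    IsColinear (omegaHom t) := t.2

theorem omegaHom_injective :
    Function.Injective (omegaHom : Omega k H (LiftAlgebra k H A M) → _) :=
  Subtype.val_injective

/-- An algebra map `t : H → E` as a linear map to all `A`-linear endomorphisms. -/
def toEndOp (t : H →ₐ[k] LiftAlgebra k H A M) :
    H →ₗ[k] (Module.End A (BalTensor (coinvariants k H A) M))ᵐᵒᵖ :=
  (LiftAlgebra k H A M).val.toLinearMap ∘ₗ t.toLinearMap

theorem inducedCoact_apply_of_isColinear {t : H →ₐ[k] LiftAlgebra k H A M} (ht : IsColinear t)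
    (h : H) (p : BalTensor (coinvariants k H A) M) :
    inducedCoact k H A M ((t h).1.unop p) =
      tensorAct A _ H ((toEndOp t).rTensor H (comul h)) (inducedCoact k H A M p) := by
  have h1 := rationalCoact_spec (t h) p
  rw [ht h, ← LinearMap.rTensor_comp_apply] at h1
  exact h1

/-- `c ⊗ w ↦ ((c ⊗_B m) ⊗ 1) · (t ⊗ H)(w)`. -/
def tensorActEval (τ : H →ₗ[k] (Module.End A (BalTensor (coinvariants k H A) M))ᵐᵒᵖ) (m : M) :
    A ⊗[k] (H ⊗[k] H) →ₗ[k] BalTensor (coinvariants k H A) M ⊗[k] H :=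
  TensorProduct.lift (LinearMap.mk₂ k
    (fun c w => tensorAct A _ H (τ.rTensor H w) (btmul _ c m ⊗ₜ[k] (1 : H)))
    (fun c c' w => by rw [add_btmul, TensorProduct.add_tmul, map_add])
    (fun r c w => by
      rw [← map_smul, TensorProduct.smul_tmul']
      exact congrArg (fun p => tensorAct A _ H (τ.rTensor H w) (p ⊗ₜ[k] (1 : H)))
        (map_smul (btmulLin k H A M m) r c))
    (fun c w w' => by rw [map_add, map_add, LinearMap.add_apply])
    (fun r c w => by rw [map_smul, map_smul, LinearMap.smul_apply]))

theorem tensorActEval_tmul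
    (τ : H →ₗ[k] (Module.End A (BalTensor (coinvariants k H A) M))ᵐᵒᵖ) (m : M) (c : A)
    (w : H ⊗[k] H) : tensorActEval τ m (c ⊗ₜ[k] w) =
      tensorAct A _ H (τ.rTensor H w) (btmul _ c m ⊗ₜ[k] (1 : H)) := rfl

/-- The second leg acts by right multiplication, so `g` can be absorbed into the acting tensor: `(p
⊗ g)·y = (p ⊗ 1)·((1 ⊗ g)y)`. -/
theorem tensorAct_btmulLin_tmul
    (τ : H →ₗ[k] (Module.End A (BalTensor (coinvariants k H A) M))ᵐᵒᵖ) (m : M) (d : A) (g : H)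
    (y : H ⊗[k] H) :
    tensorAct A _ H (τ.rTensor H y) (btmul _ d m ⊗ₜ[k] g) =
      tensorActEval τ m (d ⊗ₜ[k] (((1 : H) ⊗ₜ[k] g) * y)) := by
  rw [tensorActEval_tmul]
  induction y with
  | zero => simp
  | add x y hx hy => simp only [map_add, mul_add, LinearMap.add_apply, hx, hy]
  | tmul u v =>
    simp only [Algebra.TensorProduct.tmul_mul_tmul, LinearMap.rTensor_tmul, tensorAct_tmul, one_mul]

/-- Colinearity of `t` turns the coaction into the action of `(1 ⊗ a₍₁₎)Δ(S(a₍₂₎))` on `(a₍₀₎ ⊗ m) ⊗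
1`, and that tensor is `S(a₍₁₎) ⊗ 1`. -/
theorem inducedCoact_antipodeEval {t : H →ₐ[k] LiftAlgebra k H A M} (ht : IsColinear t)
    (a : A) (m : M) :
    inducedCoact k H A M (antipodeEvalMap t.toLinearMap m (coact a)) =
      antipodeEvalMap t.toLinearMap m (coact a) ⊗ₜ[k] (1 : H) := by
  refine rTensor_coact_induction (inducedCoact k H A M ∘ₗ antipodeEvalMap t.toLinearMap m)
    (tensorActEval (toEndOp t) m ∘ₗ (mulComulAntipode k H).lTensor A)
    ((TensorProduct.mk k _ H).flip 1 ∘ₗ antipodeEvalMap t.toLinearMap m) ?_ ?_ a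
  · intro c h
    rw [LinearMap.comp_apply, antipodeEvalMap_tmul, AlgHom.toLinearMap_apply,
      inducedCoact_apply_of_isColinear ht, inducedCoact_btmul]
    generalize (coact c : A ⊗[k] H) = x
    induction x with
    | zero => simp
    | add x y hx hy => simp only [map_add, TensorProduct.add_tmul, hx, hy]
    | tmul d g =>
      rw [TensorProduct.assoc_tmul, LinearMap.comp_apply, LinearMap.lTensor_tmul,
        mulComulAntipode_tmul, LinearMap.rTensor_tmul]
      exact tensorAct_btmulLin_tmul _ _ _ _ _
  · intro c h
    rw [LinearMap.comp_apply, LinearMap.lTensor_tmul, mulComulAntipode_comul, tensorActEval_tmul,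
      LinearMap.rTensor_tmul, tensorAct_tmul, mul_one]
    rfl

/-- Every element of `Ω_E` defines an `A`-module structure on `M` extending the `B`-module
structure. -/
theorem exists_moduleExtension (hA : IsFaithfullyFlatGalois k H A)
    {t : H →ₐ[k] LiftAlgebra k H A M} (ht : IsColinear t) :
    ∃ s : ModuleExtension k H A M, Corresponds s.rep t.toLinearMap := by
  have hex : ∀ (a : A) (m : M), ∃ m' : M,
      btmul (coinvariants k H A) 1 m' = antipodeEvalMap t.toLinearMap m (coact a) :=
    fun a m => exists_one_btmul_eq hA (inducedCoact_antipodeEval ht a m)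
  choose act hact using hex
  have hinj := one_btmul_injective (M := M) hA.faithfullyFlat
  have hB : ∀ (b : coinvariants k H A) (m : M), act (b : A) m = b • m := by
    intro b m
    apply hinj
    have hb : coact (b : A) = (b : A) ⊗ₜ[k] (1 : H) := b.2
    change btmul (coinvariants k H A) 1 _ = btmul _ 1 _
    -- For `b` in `B` the formula reads `t(S(1))(b ⊗ m) = b ⊗ m = 1 ⊗ bm`.
    rw [hact, hb, antipodeEvalMap_tmul, antipode_one, AlgHom.toLinearMap_apply, map_one,
      liftAlgebra_one_apply, ← btmul_mul_coe, one_mul]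
  let s : Module A M :=
    { smul := act
      one_smul := fun m => by
        have := hB 1 m
        rwa [one_smul] at this
      mul_smul := fun a b m => hinj (by
        change btmul (coinvariants k H A) 1 (act (a * b) m) = btmul _ 1 (act a (act b m))
        rw [hact, hact, RightComoduleAlgebra.coact_mul]
        generalize (coact a : A ⊗[k] H) = x
        induction x with
        | zero => simp
        | add x y hx hy => simp only [map_add, add_mul, hx, hy]
        | tmul c g =>
          rw [antipodeEvalMap_mul, antipodeEvalMap_tmul, ← hact, smul_btmul, mul_one]
          rfl)
      smul_zero := fun a => hinj (by
        change btmul (coinvariants k H A) 1 (act a 0) = btmul _ 1 0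
        rw [hact, antipodeEvalMap_zero, btmul_zero])
      smul_add := fun a m m' => hinj (by
        change btmul (coinvariants k H A) 1 (act a (m + m')) = btmul _ 1 (act a m + act a m')
        rw [hact, antipodeEvalMap_add, btmul_add, hact, hact])
      add_smul := fun a b m => hinj (by
        change btmul (coinvariants k H A) 1 (act (a + b) m) = btmul _ 1 (act a m + act b m)
        rw [hact, map_add, map_add, btmul_add, hact, hact])
      zero_smul := fun m => hinj (by
        change btmul (coinvariants k H A) 1 (act 0 m) = btmul _ 1 0
        rw [hact, map_zero, map_zero, btmul_zero]) }
  exact ⟨⟨s, hB⟩, hact⟩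

/-- The endomorphism `A ⊗_B f` as a coinvariant element of `E`. -/
def liftCoinvariant (f : M →ₗ[coinvariants k H A] M) :
    coinvariants k H (LiftAlgebra k H A M) :=
  let F : Module.End A (BalTensor (coinvariants k H A) M) :=
    { balMap _ f with map_smul' := balMap_smul f }
  -- The witness `F ⊗ 1` expresses that `A ⊗_B f` is colinear; it yields rationality and
  -- coinvariance at once.
  have hF : IsRationalWith (op F) (op F ⊗ₜ[k] (1 : H)) := fun p => by
    rw [tensorAct_tmul_one]
    change inducedCoact k H A M (balMap _ f p) =
      (balMap _ f).rTensor H (inducedCoact k H A M p)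
    induction p using btmul_induction with
    | zero => simp
    | add x y hx hy => simp only [map_add, hx, hy]
    | btmul a m =>
      rw [balMap_btmul, inducedCoact_btmul, inducedCoact_btmul, ← LinearMap.rTensor_comp_apply]
      rfl
  ⟨⟨op F, _, hF⟩, rationalCoact_eq hF⟩

theorem liftCoinvariant_btmul (f : M →ₗ[coinvariants k H A] M) (a : A) (m : M) :
    (liftCoinvariant f).1.1.unop (btmul _ a m) = btmul _ a (f m) := rfl

theorem liftCoinvariant_mul_eq_one {f g : M →ₗ[coinvariants k H A] M}
    (h : ∀ m, g (f m) = m) : liftCoinvariant f * liftCoinvariant g = 1 := by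
  refine Subtype.ext (Subtype.ext (unop_injective (LinearMap.ext fun p => ?_)))
  change (liftCoinvariant g).1.1.unop ((liftCoinvariant f).1.1.unop p) = p
  induction p using btmul_induction with
  | zero => simp
  | add x y hx hy => simp only [map_add, hx, hy]
  | btmul a m => rw [liftCoinvariant_btmul, liftCoinvariant_btmul, h]

/-- Coinvariance of `b` gives the rationality witness `b ⊗ 1`, so `b` is colinear on `P` and
preserves the coinvariants of `P`. -/
theorem inducedCoact_coinvariant (b : coinvariants k H (LiftAlgebra k H A M))
    (p : BalTensor (coinvariants k H A) M) :
    inducedCoact k H A M (b.1.1.unop p) =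
      (b.1.1.unop.restrictScalars k).rTensor H (inducedCoact k H A M p) := by
  have h1 := rationalCoact_spec b.1 p
  have h2 : rationalCoact b.1 = b.1 ⊗ₜ[k] (1 : H) := b.2
  rw [h2, LinearMap.rTensor_tmul] at h1
  exact h1.trans (tensorAct_tmul_one _ _)

variable {s₁ s₂ : ModuleExtension k H A M} {t₁ t₂ : Omega k H (LiftAlgebra k H A M)}

/-- By descent, each coinvariant `c` of `E` restricts along `m ↦ 1 ⊗ m` to an additive map `r c` of
`M`; for a unit this is bijective. -/
theorem extension_equiv_of_omega_equiv (hA : IsFaithfullyFlatGalois k H A)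
    (h₁ : Corresponds s₁.rep (omegaHom t₁).toLinearMap)
    (h₂ : Corresponds s₂.rep (omegaHom t₂).toLinearMap)
    (h : (omegaSetoid k H (LiftAlgebra k H A M)).r t₁ t₂) :
    (extensionSetoid k H A M).r s₁ s₂ := by
  obtain ⟨b, hb⟩ := h
  have hinj := one_btmul_injective (M := M) hA.faithfullyFlat
  have hex : ∀ (c : coinvariants k H (LiftAlgebra k H A M)) (m : M),
      ∃ m' : M, btmul _ 1 m' = c.1.1.unop (btmul _ 1 m) := fun c m =>
    exists_one_btmul_eq hA (by
      rw [inducedCoact_coinvariant, inducedCoact_one_btmul]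
      rfl)
  choose r hr using hex
  have hr1 : ∀ c d, d * c = 1 → ∀ m, r c (r d m) = m := fun c d hdc m => hinj (by
    change btmul (coinvariants k H A) 1 (r c (r d m)) = btmul _ 1 m
    rw [hr, hr]
    change (d * c).1.1.unop (btmul _ 1 m) = _
    rw [hdc]
    rfl)
  have hradd : ∀ c m m', r c (m + m') = r c m + r c m' := fun c m m' => hinj (by
    change btmul (coinvariants k H A) 1 (r c (m + m')) = btmul _ 1 (r c m + r c m')
    rw [hr, btmul_add, map_add, btmul_add, hr, hr])
  let f : M ≃+ M :=
    { toFun := r b.1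
      invFun := r b⁻¹.1
      left_inv := hr1 _ _ b.mul_inv
      right_inv := hr1 _ _ b.inv_mul
      map_add' := hradd _ }
  -- In terms of composition the relation reads `t₁(h) ∘ b = b ∘ t₂(h)`, so `f` goes from `s₂` to
  -- `s₁`; hence the symmetry.
  refine (extensionSetoid k H A M).symm ⟨f, fun a m => hinj ?_⟩
  change btmul (coinvariants k H A) 1 (r b.1 (s₂.rep a m)) = btmul _ 1 (s₁.rep a (r b.1 m))
  rw [hr, h₂, h₁, antipodeEval_eq, antipodeEval_eq]
  generalize (coact a : A ⊗[k] H) = x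
  induction x with
  | zero => simp
  | add x y hx hy => simp only [map_add, hx, hy]
  | tmul c h =>
    have : (omegaHom t₁ (antipode k h)).1.unop (b.1.1.1.unop (btmul _ c m)) =
        b.1.1.1.unop ((omegaHom t₂ (antipode k h)).1.unop (btmul _ c m)) :=
      LinearMap.congr_fun (congrArg (fun e : LiftAlgebra k H A M => e.1.unop)
        (hb (antipode k h))) (btmul _ c m)
    -- By `A`-linearity, `b(1 ⊗ m) = 1 ⊗ r(m)` extends to `b(c ⊗ m) = c ⊗ r(m)`.
    rw [antipodeEvalMap_tmul, antipodeEvalMap_tmul, btmul_eq_smul c (r b.1 m), hr, ← map_smul,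
      ← btmul_eq_smul]
    exact this.symm

/-- The conjugating unit is `A ⊗_B e⁻¹`: because the product of `E` is reversed, the inverse
isomorphism, from `s₂` to `s₁`, is the one needed. -/
theorem omega_equiv_of_extension_equiv (hA : IsFaithfullyFlatGalois k H A)
    (h₁ : Corresponds s₁.rep (omegaHom t₁).toLinearMap)
    (h₂ : Corresponds s₂.rep (omegaHom t₂).toLinearMap)
    (h : (extensionSetoid k H A M).r s₁ s₂) :
    (omegaSetoid k H (LiftAlgebra k H A M)).r t₁ t₂ := by
  obtain ⟨e, he⟩ := h
  let f : M →ₗ[coinvariants k H A] M :=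
    { e with
      map_smul' := fun b m => by
        change e (b • m) = b • e m
        rw [← s₁.rep_restrictsTo, ← s₂.rep_restrictsTo]
        exact he _ _ }
  have he' : ∀ a m, e.symm (s₂.rep a m) = s₁.rep a (e.symm m) := fun a m => by
    rw [AddEquiv.symm_apply_eq]
    exact ((he a (e.symm m)).trans (by rw [AddEquiv.apply_symm_apply]; rfl)).symm
  let g : M →ₗ[coinvariants k H A] M :=
    { e.symm with
      map_smul' := fun b m => by
        change e.symm (b • m) = b • e.symm m
        rw [← s₂.rep_restrictsTo, ← s₁.rep_restrictsTo]
        exact he' _ _ }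
  -- Naturality of the inverse Galois isomorphism in the `A`-module, checked on the image of the
  -- Galois map.
  have hg : ∀ y : M ⊗[k] H, (liftCoinvariant g).1.1.unop (evalOne (omegaHom t₂).toLinearMap y) =
      evalOne (omegaHom t₁).toLinearMap ((g.restrictScalars k).rTensor H y) := by
    intro y
    obtain ⟨p, rfl⟩ := galoisMap_surjective s₂.rep_restrictsTo hA.galois.surjective y
    rw [evalOne_galoisMap _ h₂]
    induction p using btmul_induction with
    | zero => simp
    | add x y hx hy => simp only [map_add, hx, hy]
    | btmul a m =>
      have h3 : g.restrictScalars k ∘ₗ s₂.rep.toLinearMap.flip m =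
          s₁.rep.toLinearMap.flip (g m) := LinearMap.ext fun c => he' c m
      rw [galoisMap_btmul, ← LinearMap.rTensor_comp_apply,
        h3, ← galoisMap_btmul s₁.rep_restrictsTo, evalOne_galoisMap _ h₁, liftCoinvariant_btmul]
  refine ⟨⟨liftCoinvariant g, liftCoinvariant f,
    liftCoinvariant_mul_eq_one e.apply_symm_apply,
    liftCoinvariant_mul_eq_one e.symm_apply_apply⟩, fun h => ?_⟩
  refine Subtype.ext (unop_injective (LinearMap.ext fun p => ?_))
  change (omegaHom t₁ h).1.unop ((liftCoinvariant g).1.1.unop p) =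
    (liftCoinvariant g).1.1.unop ((omegaHom t₂ h).1.unop p)
  -- Once `p` is written as a value of `evalOne`, `t₁(h)` and `t₂(h)` act by right multiplication on
  -- the factor `H` and the unit acts by `g` on the factor `M`, so they commute.
  rw [← evalOne_galoisMap s₂.rep_restrictsTo h₂ p, hg, ← evalOne_lTensor_mulRight,
    ← evalOne_lTensor_mulRight, hg, ← LinearMap.comp_apply (LinearMap.lTensor _ _),
    LinearMap.lTensor_comp_rTensor, ← LinearMap.rTensor_comp_lTensor, LinearMap.comp_apply]

/-- The bijection between `A`-module structures on `M` and elements of `Ω_E`. -/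
def extensionEquivOmega (hA : IsFaithfullyFlatGalois k H A) :
    ModuleExtension k H A M ≃ Omega k H (LiftAlgebra k H A M) :=
  Equiv.ofBijective (fun s => translationOmega s.rep_restrictsTo hA.galois) (by
    constructor
    · intro s s' h
      have hs := translation_corresponds s.rep_restrictsTo hA.galois
      have hs' := translation_corresponds s'.rep_restrictsTo hA.galois
      refine ModuleExtension.rep_injective (hs.rep_unique hA ?_)
      rwa [show translationAlgHom s.rep_restrictsTo hA.galois =
        translationAlgHom s'.rep_restrictsTo hA.galois from congrArg omegaHom h]
    · intro t
      obtain ⟨s, hs⟩ := exists_moduleExtension hA (omegaHom_isColinear t)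
      exact ⟨s, omegaHom_injective (Corresponds.algHom_unique hA.galois s.rep_restrictsTo
        (translation_corresponds s.rep_restrictsTo hA.galois) hs)⟩)

theorem extensionEquivOmega_corresponds (hA : IsFaithfullyFlatGalois k H A)
    (s : ModuleExtension k H A M) :
    Corresponds s.rep (omegaHom (extensionEquivOmega hA s)).toLinearMap :=
  translation_corresponds s.rep_restrictsTo hA.galois

end Extensions

end HopfLifting

end

/-! ### Passage to classes. -/

theorem corollary4p13 {k : Type v} {H A M : Type u} [Field k] [Ring H] [HopfAlgebra k H]
    [HopfLifting.HasBijectiveAntipode k H] [Ring A] [Algebra k A]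
    [HopfLifting.RightComoduleAlgebra k H A] (hA : HopfLifting.IsFaithfullyFlatGalois k H A)
    [AddCommGroup M] [Module k M] [Module (HopfLifting.coinvariants k H A) M]
    [IsScalarTower k (HopfLifting.coinvariants k H A) M] :
    ∃ Φ : HopfLifting.ExtensionClasses k H A M ≃
        HopfLifting.OmegaBar k H (HopfLifting.LiftAlgebra k H A M),
      ∀ s : HopfLifting.ModuleExtension k H A M,
        ∃ t : HopfLifting.Omega k H (HopfLifting.LiftAlgebra k H A M),
          Φ (Quotient.mk (HopfLifting.extensionSetoid k H A M) s) =
            Quotient.mk (HopfLifting.omegaSetoid k H (HopfLifting.LiftAlgebra k H A M)) t ∧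
          ∀ (a : A) (m : M),
            HopfLifting.btmul (HopfLifting.coinvariants k H A) 1 (s.act a m) =
              HopfLifting.antipodeEval t.1.toLinearMap a m :=
  ⟨Quotient.congr (HopfLifting.extensionEquivOmega hA) fun s₁ s₂ =>
    ⟨HopfLifting.omega_equiv_of_extension_equiv hA
      (HopfLifting.extensionEquivOmega_corresponds hA s₁)
      (HopfLifting.extensionEquivOmega_corresponds hA s₂),
    HopfLifting.extension_equiv_of_omega_equiv hA
      (HopfLifting.extensionEquivOmega_corresponds hA s₁)
      (HopfLifting.extensionEquivOmega_corresponds hA s₂)⟩,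
    fun s => ⟨HopfLifting.extensionEquivOmega hA s, rfl,
      HopfLifting.extensionEquivOmega_corresponds hA s⟩⟩
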